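/- Let $n\ge 1$ and let $P$ be an $n$-dimensional simple convex polytope (the convex hull of finitely many points in a finite-dimensional real vector space, of dimension $n$, each vertex of which lies on exactly $n$ facets) with vertex set $V(P)$ and exactly $m$ facets. Let $\mathcal F(P)$ be the set of facets. For a nonempty face $f$ of $P$ let $\xi_f\in\mathbb F_2^{V(P)}$ be the vector whose entry at a vertex $v$ is $1$ if $v\in f$ and $0$ otherwise, and let $$\mathfrak B_k(P)=\operatorname{Span}_{\mathbb F_2}\{\xi_f : f \text{ is a face of } P \text{ of codimension } k\}\subset\mathbb F_2^{V(P)},$$ so that $\mathfrak B_{-1}(P)=0$. Call $P$ $n$-colorable if its facets can be colored with $n$ colors so that any two distinct facets that intersect have different colors. Then the following four statements are equivalent: (1) $P$ is $n$-colorable; (2) there is a partition $\mathcal F_1,\dots,\mathcal F_n$ of $\mathcal F(P)$ such that, for each $i$, the facets in $\mathcal F_i$ are pairwise disjoint and $\sum_{F\in\mathcal F_i}\xi_F=(1,\dots,1)$ (that is, each vertex of $P$ lies on exactly one facet from $\mathcal F_i$); (3) $\mathfrak B_0(P)\subset\mathfrak B_1(P)\subset\cdots\subset\mathfrak B_{n-1}(P)\subset\mathfrak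 B_n(P)=\mathbb F_2^{V(P)}$; (4) $\mathfrak B_{n-2}(P)\subset\mathfrak B_{n-1}(P)$. If moreover $n\ne 2$, then they are also equivalent to (5) $\dim_{\mathbb F_2}\mathfrak B_1(P)=m-n+1$. -/

import Mathlib

section FaceCodes

variable {E : Type*} [NormedAddCommGroup E] [NormedSpace ℝ E]

/-- A convex polytope: the convex hull of finitely many points. -/
def IsConvexPolytope (P : Set E) : Prop :=
  ∃ S : Finset E, P = convexHull ℝ (S : Set E)

/-- The dimension of a nonempty convex set: the dimension of its affine hull. -/
noncomputable def polyDim (f : Set E) : ℕ :=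
  Module.finrank ℝ (vectorSpan ℝ f)

/-- The nonempty faces of `P`: the sets on which some linear functional attains its maximum
over `P` (the zero functional gives `P` itself). -/
def IsPolyFace (P f : Set E) : Prop :=
  f.Nonempty ∧ IsExposed ℝ P f

/-- Faces of codimension `k`. There are none unless `0 ≤ k ≤ polyDim P`. -/
def IsCodimFace (P : Set E) (k : ℤ) (f : Set E) : Prop :=
  IsPolyFace P f ∧ (polyDim f : ℤ) = (polyDim P : ℤ) - k

/-- The set of facets, that is, of faces of codimension one. -/
def polyFacets (P : Set E) : Set (Set E) :=
  {F | IsCodimFace P 1 F}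

/-- `P` is a simple polytope of dimension `n`: a convex polytope of dimension `n` each of whose
vertices lies on exactly `n` facets. -/
structure IsSimplePolytope (n : ℕ) (P : Set E) : Prop where
  isConvexPolytope : IsConvexPolytope P
  polyDim_eq : polyDim P = n
  ncard_facets : ∀ v ∈ P.extremePoints ℝ, {F ∈ polyFacets P | v ∈ F}.ncard = n

/-- The facets of `P` can be coloured with `n` colours so that any two distinct facets that meet
have different colours. -/
def IsPolyColorable (n : ℕ) (P : Set E) : Prop :=
  ∃ c : polyFacets P → Fin n, ∀ F G : polyFacets P,
    F ≠ G → ((F : Set E) ∩ (G : Set E)).Nonempty → c F ≠ c G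

open Classical in
/-- The vector `ξ_f` over `𝔽₂`, indexed by the vertices of `P`: its entry at `v` is `1` if `v`
is a vertex of `f`, and `0` otherwise. -/
noncomputable def faceVector (P f : Set E) : P.extremePoints ℝ → ZMod 2 :=
  fun v => if (v : E) ∈ f then 1 else 0

/-- The codimension-`k` face code of `P`: the span over `𝔽₂` of the vectors `ξ_f`, where `f` runs
through the faces of codimension `k`. -/
def faceCode (P : Set E) (k : ℤ) : Submodule (ZMod 2) (P.extremePoints ℝ → ZMod 2) :=
  Submodule.span (ZMod 2) {x | ∃ f, IsCodimFace P k f ∧ x = faceVector P f}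

/-- There is a partition of the set of facets into `n` classes such that the facets of each class
are pairwise disjoint and their vectors `ξ_F` add up to the all-one vector. -/
def HasFacetPartition (n : ℕ) (P : Set E) : Prop :=
  ∃ 𝓕 : Fin n → Finset (Set E),
    (∀ F : Set E, F ∈ polyFacets P ↔ ∃ i, F ∈ 𝓕 i) ∧
    (∀ i j, i ≠ j → Disjoint (𝓕 i) (𝓕 j)) ∧
    ∀ i, (∀ F ∈ 𝓕 i, ∀ G ∈ 𝓕 i, F ≠ G → Disjoint F G) ∧
      ∑ F ∈ 𝓕 i, faceVector P F = 1

end FaceCodes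

/-! ### Exposed faces of a polytope and separation at a vertex. -/

section Polytope

variable {E : Type*} [NormedAddCommGroup E] [NormedSpace ℝ E]

/-! Convex geometry enters only through local coordinates. At a vertex `v` of a simple polytope, the
`n` facets through `v` give linear coordinates with a dual basis of edge directions
(`exists_isVertexFrame`). Hence the faces through `v` are the intersections of the facets through
`v`, each such facet can be dropped along exactly one edge, and a vertex that is not lowest on a
face has a descending edge in it. `IsSimpleIncidence` records this with a generic linear height;
everything else is combinatorics and linear algebra over 𝔽₂.

A proper colouring puts each vertex on exactly one facet of each colour. The colour classes
therefore give the partition, and a face vector is the sum of the vectors of its intersections with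
the facets of a colour absent from that face; this gives the chain of inclusions. Conversely, 𝔅ₙ₋₂ ⊂
𝔅ₙ₋₁ forces every 2-face to have an even number of vertices, because edges have two. Adding vertices
in order of height, one then extends a colouring step by step; parity settles the only case where
two facets might clash (`exists_proper_on_lower`).

For the dimension of 𝔅₁, consider linear relations among the facet vectors. A relation is determined
by its values on the facets at one vertex, and these values add up to zero, so the relations have
dimension at most `n - 1`. A colouring attains this bound. Conversely, if it is attained and `n ≥
3`, the relations separate the facets at a base vertex and match every facet with one of them, which
is a colouring. -/

theorem IsConvexPolytope.convex {P : Set E} (hP : IsConvexPolytope P) : Convex ℝ P := by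
  obtain ⟨S, rfl⟩ := hP
  exact convex_convexHull ℝ _

theorem IsConvexPolytope.isCompact {P : Set E} (hP : IsConvexPolytope P) : IsCompact P := by
  obtain ⟨S, rfl⟩ := hP
  exact S.finite_toSet.isCompact_convexHull ℝ

theorem IsConvexPolytope.finite_extremePoints {P : Set E} (hP : IsConvexPolytope P) :
    (P.extremePoints ℝ).Finite := by
  obtain ⟨S, rfl⟩ := hP
  exact S.finite_toSet.subset extremePoints_convexHull_subset

theorem IsPolyFace.exists_functional {P f : Set E} (hf : IsPolyFace P f) {v : E} (hv : v ∈ f) :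
    ∃ l : E →L[ℝ] ℝ, (∀ x ∈ P, l x ≤ l v) ∧ f = {x ∈ P | l x = l v} := by
  obtain ⟨l, hl⟩ := hf.2 hf.1
  have hv' := hv
  rw [hl] at hv'
  refine ⟨l, hv'.2, ?_⟩
  rw [hl]
  ext x
  simp only [Set.mem_ofPred_eq]
  constructor
  · rintro ⟨hx, h⟩
    exact ⟨hx, le_antisymm (hv'.2 x hx) (h v hv'.1)⟩
  · rintro ⟨hx, h⟩
    exact ⟨hx, fun y hy => h ▸ hv'.2 y hy⟩

theorem isPolyFace_setOf_eq {P : Set E} {v : E} (hv : v ∈ P) (l : E →L[ℝ] ℝ)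
    (hl : ∀ x ∈ P, l x ≤ l v) : IsPolyFace P {x ∈ P | l x = l v} := by
  refine ⟨⟨v, hv, rfl⟩, fun _ => ⟨l, ?_⟩⟩
  ext x
  simp only [Set.mem_ofPred_eq]
  constructor
  · rintro ⟨hx, h⟩
    exact ⟨hx, fun y hy => h ▸ hl y hy⟩
  · rintro ⟨hx, h⟩
    exact ⟨hx, le_antisymm (hl x hx) (h v hv)⟩

theorem IsPolyFace.subset {P f : Set E} (hf : IsPolyFace P f) : f ⊆ P := hf.2.subset

theorem IsPolyFace.extremePoints_eq {P f : Set E} (hf : IsPolyFace P f) :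
    f.extremePoints ℝ = f ∩ P.extremePoints ℝ := hf.2.isExtreme.extremePoints_eq

theorem IsPolyFace.exists_vertex {P f : Set E} (hP : IsConvexPolytope P) (hf : IsPolyFace P f) :
    ∃ v ∈ P.extremePoints ℝ, v ∈ f := by
  obtain ⟨v, hv⟩ := (hf.2.isCompact hP.isCompact).extremePoints_nonempty hf.1
  rw [hf.extremePoints_eq] at hv
  exact ⟨v, hv.2, hv.1⟩

theorem IsPolyFace.inter_exists_vertex {P f g : Set E} (hP : IsConvexPolytope P)
    (hf : IsPolyFace P f) (hg : IsPolyFace P g) (hfg : (f ∩ g).Nonempty) :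
    ∃ v ∈ P.extremePoints ℝ, v ∈ f ∧ v ∈ g :=
  IsPolyFace.exists_vertex hP (f := f ∩ g) ⟨hfg, hf.2.inter hg.2⟩

theorem IsPolyFace.eq_closure {P f : Set E} (hP : IsConvexPolytope P) (hf : IsPolyFace P f) :
    f = closure (convexHull ℝ (f ∩ P.extremePoints ℝ)) := by
  rw [← hf.extremePoints_eq]
  exact (closure_convexHull_extremePoints (hf.2.isCompact hP.isCompact)
    (hf.2.convex hP.convex)).symm

/-- By Krein–Milman a face is recovered from its vertices, and these form a subset of a finite set.
-/
theorem finite_setOf_isPolyFace {P : Set E} (hP : IsConvexPolytope P) :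
    {f | IsPolyFace P f}.Finite := by
  refine Set.Finite.of_finite_image (f := fun f => f ∩ P.extremePoints ℝ)
    (hP.finite_extremePoints.finite_subsets.subset ?_) ?_
  · rintro _ ⟨f, -, rfl⟩
    exact Set.inter_subset_right
  · intro f hf g hg h
    rw [hf.eq_closure hP, hg.eq_closure hP]
    exact congrArg (fun s => closure (convexHull ℝ s)) h

theorem finite_polyFacets {P : Set E} (hP : IsConvexPolytope P) : (polyFacets P).Finite :=
  (finite_setOf_isPolyFace hP).subset fun _ hF => hF.1

theorem vectorSpan_convexHull (S : Set E) : vectorSpan ℝ (convexHull ℝ S) = vectorSpan ℝ S := by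
  rw [← direction_affineSpan, affineSpan_convexHull, direction_affineSpan]

section

variable {V : Type*} [AddCommGroup V] [Module ℝ V] [FiniteDimensional ℝ V]

/-- A linear functional that is nonpositive on a finite set and positive at `y` can be chosen
so that its zeros in that set span a hyperplane of the span of the set. -/
theorem exists_functional_finrank_zeros (T : Finset V) (y : V)
    (l₀ : Module.Dual ℝ V) (h₀ : ∀ s ∈ T, l₀ s ≤ 0) (h₀y : 0 < l₀ y) :
    ∃ l : Module.Dual ℝ V, (∀ s ∈ T, l s ≤ 0) ∧ 0 < l y ∧
      Module.finrank ℝ (Submodule.span ℝ (T : Set V)) ≤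
        Module.finrank ℝ (Submodule.span ℝ {s : V | s ∈ T ∧ l s = 0}) + 1 := by
  classical
  set r : Module.Dual ℝ V → ℕ := fun l =>
    Module.finrank ℝ (Submodule.span ℝ {s : V | s ∈ T ∧ l s = 0}) with hr
  set G : Set (Module.Dual ℝ V) := {l | (∀ s ∈ T, l s ≤ 0) ∧ 0 < l y} with hG
  have hfin : (r '' G).Finite := by
    refine (Set.finite_Iic (Module.finrank ℝ V)).subset ?_
    rintro _ ⟨l, -, rfl⟩
    exact Submodule.finrank_le _
  obtain ⟨l, ⟨hl, hly⟩, hmax⟩ := hfin.exists_maximalFor' r G ⟨l₀, h₀, h₀y⟩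
  refine ⟨l, hl, hly, ?_⟩
  by_contra! hlt
  set N : Submodule ℝ V := Submodule.span ℝ {s : V | s ∈ T ∧ l s = 0} with hN
  have hU : ¬ (Submodule.span ℝ (T : Set V) ≤ N ⊔ Submodule.span ℝ {y}) := by
    intro h
    have h1 := Submodule.finrank_mono h
    have h2 := Submodule.finrank_add_le_finrank_add_finrank N (Submodule.span ℝ {y})
    have h3 := finrank_span_le_card (R := ℝ) ({y} : Set V)
    simp only [Set.toFinset_singleton, Finset.card_singleton] at h3
    omega
  obtain ⟨s, hsT, hs⟩ : ∃ s ∈ T, s ∉ N ⊔ Submodule.span ℝ {y} := by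
    by_contra! h
    exact hU (Submodule.span_le.2 h)
  obtain ⟨g₀, hg₀s, hg₀⟩ := Submodule.exists_le_ker_of_notMem hs
  obtain ⟨g, hgs, hgN, hgy⟩ : ∃ g : Module.Dual ℝ V, 0 < g s ∧ (∀ x ∈ N, g x = 0) ∧ g y = 0 := by
    have hN0 : ∀ x ∈ N, g₀ x = 0 := fun x hx => hg₀ (Submodule.mem_sup_left hx)
    have hy0 : g₀ y = 0 := hg₀ (Submodule.mem_sup_right (Submodule.mem_span_singleton_self y))
    rcases lt_or_gt_of_ne hg₀s with h | h
    · exact ⟨-g₀, by simpa using h, fun x hx => by simp [hN0 x hx], by simp [hy0]⟩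
    · exact ⟨g₀, h, hN0, hy0⟩
  -- Ratio test: the minimum ratio is the largest step along `g` that keeps the functional
  -- nonpositive on `T`. The minimiser `u` becomes a new zero, old zeros survive because `g` kills
  -- `N`, and the value at `y` is unchanged. This contradicts maximality of the rank.
  obtain ⟨u, hu, humin⟩ := Finset.exists_min_image (T.filter fun x => 0 < g x)
    (fun x => -l x / g x) ⟨s, by simp [hsT, hgs]⟩
  rw [Finset.mem_filter] at hu
  set t : ℝ := -l u / g u with ht
  have ht0 : 0 ≤ t := div_nonneg (by linarith [hl u hu.1]) hu.2.le
  have hmem : l + t • g ∈ G := by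
    refine ⟨fun x hx => ?_, by simp [hgy, hly]⟩
    simp only [LinearMap.add_apply, LinearMap.smul_apply, smul_eq_mul]
    rcases le_or_gt (g x) 0 with h | h
    · nlinarith [hl x hx]
    · have := humin x (by simp [hx, h])
      rw [le_div_iff₀ h] at this
      linarith
  have hle : N ≤ Submodule.span ℝ {x : V | x ∈ T ∧ (l + t • g) x = 0} := by
    refine Submodule.span_mono ?_
    rintro x ⟨hx, hlx⟩
    exact ⟨hx, by simp [hlx, hgN x (Submodule.subset_span ⟨hx, hlx⟩)]⟩
  have hu' : u ∈ Submodule.span ℝ {x : V | x ∈ T ∧ (l + t • g) x = 0} := by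
    refine Submodule.subset_span ⟨hu.1, ?_⟩
    simp only [LinearMap.add_apply, LinearMap.smul_apply, smul_eq_mul, ht]
    field_simp [hu.2.ne']
    ring
  have huN : u ∉ N := fun h => hu.2.ne' (hgN u h)
  have hlt' : r l < r (l + t • g) :=
    Submodule.finrank_lt_finrank_of_lt (lt_of_le_of_ne hle fun h => huN (by rw [hN, h]; exact hu'))
  exact absurd (hmax hmem hlt'.le) (not_le.2 hlt')

end

/-- If the ray from a vertex `v` in the direction `y` leaves `P` at once, some facet through `v`
separates it from `P`. -/
theorem exists_facet_functional_pos {P : Set E} (hP : IsConvexPolytope P)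
    {v : E} (hv : v ∈ P.extremePoints ℝ) [FiniteDimensional ℝ E] {y : E}
    (hy : y ∈ vectorSpan ℝ P) (hout : ∀ ε : ℝ, 0 < ε → v + ε • y ∉ P) :
    ∃ l : E →L[ℝ] ℝ, (∀ x ∈ P, l x ≤ l v) ∧ 0 < l y ∧
      polyDim {x ∈ P | l x = l v} + 1 = polyDim P := by
  classical
  obtain ⟨S, hS⟩ := hP
  have hvS : v ∈ S := by
    rw [hS] at hv
    exact extremePoints_convexHull_subset hv
  have hvP : v ∈ P := hv.1
  have hy0 : y ≠ 0 := by
    rintro rfl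
    exact hout 1 one_pos (by simpa using hvP)
  have hSP : ∀ s ∈ S, s ∈ P := fun s hs => hS ▸ subset_convexHull ℝ _ hs
  -- the convex hull of the other points misses the ray
  have hQP : convexHull ℝ ((S.erase v : Finset E) : Set E) ⊆ P := by
    rw [hS]; exact convexHull_mono (by simp)
  have hQv : v ∉ convexHull ℝ ((S.erase v : Finset E) : Set E) := by
    have hconv : Convex ℝ P := hS ▸ convex_convexHull ℝ _
    have := (hconv.mem_extremePoints_iff_mem_sdiff_convexHull_sdiff.1 hv).2
    refine fun h => this (convexHull_mono ?_ h)
    intro x hx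
    simp only [Finset.coe_erase, Set.mem_sdiff, Finset.mem_coe, Set.mem_singleton_iff] at hx
    exact ⟨hSP x hx.1, hx.2⟩
  set R : Set E := (fun t : ℝ => v + t • y) '' Set.Ici 0 with hR
  have hRconv : Convex ℝ R := by
    have : R = (AffineMap.lineMap v (v + y) : ℝ →ᵃ[ℝ] E) '' Set.Ici 0 := by
      rw [hR]
      refine Set.image_congr fun t _ => ?_
      simp [AffineMap.lineMap_apply, add_comm]
    rw [this]
    exact (convex_Ici 0).affine_image _
  have hRclosed : IsClosed R := by
    have h1 : Topology.IsClosedEmbedding fun t : ℝ => t • y := isClosedEmbedding_smul_left hy0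
    have h2 : Topology.IsClosedEmbedding fun t : ℝ => v + t • y :=
      (Homeomorph.addLeft v).isClosedEmbedding.comp h1
    exact h2.isClosedMap _ isClosed_Ici
  have hdisj : Disjoint (convexHull ℝ ((S.erase v : Finset E) : Set E)) R := by
    rw [Set.disjoint_left]
    rintro _ hx ⟨t, ht, rfl⟩
    rcases (show (0 : ℝ) ≤ t from ht).eq_or_lt with h | h
    · apply hQv
      simpa [← h] using hx
    · exact hout t h (hQP hx)
  obtain ⟨f, a, b, hfa, hab, hfb⟩ := geometric_hahn_banach_compact_closed
    (convex_convexHull ℝ _) ((S.erase v).finite_toSet.isCompact_convexHull ℝ) hRconv hRclosed hdisj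
  have hfv : ∀ s ∈ S, s ≠ v → f (s - v) < 0 := by
    intro s hs hsv
    have h1 := hfa s (subset_convexHull ℝ _ (by simp [hs, hsv]))
    have h2 := hfb v ⟨0, by simp, by simp⟩
    rw [map_sub]; linarith
  have hfy : 0 ≤ f y := by
    by_contra! h
    have h1 := hfb v ⟨0, by simp, by simp⟩
    have h0 : 0 ≤ (f v - b) / (-f y) := div_nonneg (by linarith) (by linarith)
    have h2 := hfb _ ⟨(f v - b) / (-f y), h0, rfl⟩
    dsimp only at h2
    rw [map_add, map_smul, smul_eq_mul] at h2
    have : (f v - b) / (-f y) * f y = -(f v - b) := by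
      rw [div_neg, neg_mul, div_mul_cancel₀ _ h.ne]
    linarith
  obtain ⟨g, hg⟩ : ∃ g : Module.Dual ℝ E, g y ≠ 0 := by
    by_contra! h
    exact hy0 ((Module.forall_dual_apply_eq_zero_iff ℝ y).1 h)
  obtain ⟨g, hg⟩ : ∃ g : Module.Dual ℝ E, 0 < g y := by
    rcases lt_or_gt_of_ne hg with h | h
    · exact ⟨-g, by simpa using h⟩
    · exact ⟨g, h⟩
  -- Separation only yields `0 ≤ f y`. Adding a small multiple of `g` makes the value at `y`
  -- positive, while the finitely many strict inequalities at the other generators persist.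
  have hev : ∀ᶠ ε : ℝ in nhdsWithin 0 (Set.Ioi 0), ∀ s ∈ S.erase v,
      f (s - v) + ε * g (s - v) < 0 := by
    rw [Filter.eventually_all_finset]
    intro s hs
    have hc : ContinuousAt (fun ε : ℝ => f (s - v) + ε * g (s - v)) 0 := by fun_prop
    have := hc.tendsto.mono_left (nhdsWithin_le_nhds (s := Set.Ioi 0))
    refine this.eventually_lt_const ?_
    simpa using hfv s (Finset.mem_of_mem_erase hs) (Finset.ne_of_mem_erase hs)
  obtain ⟨ε, hε, hε0⟩ := (hev.and self_mem_nhdsWithin).exists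
  have hε0 : 0 < ε := hε0
  set T : Finset E := S.image fun s => s - v with hT
  have hspan : vectorSpan ℝ P = Submodule.span ℝ (T : Set E) := by
    rw [hS, vectorSpan_convexHull, vectorSpan_eq_span_vsub_set_right ℝ (Finset.mem_coe.2 hvS)]
    simp [hT]
  obtain ⟨l, hl, hly, hrank⟩ := exists_functional_finrank_zeros T y
    ((f : E →ₗ[ℝ] ℝ) + ε • g) (by
      intro x hx
      obtain ⟨s, hs, rfl⟩ := Finset.mem_image.1 hx
      by_cases hsv : s = v
      · simp [hsv]
      · simpa using (hε s (by simp [hs, hsv])).le) (by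
      have : 0 < ε * g y := mul_pos hε0 hg
      simp only [LinearMap.add_apply, LinearMap.smul_apply, smul_eq_mul,
        ContinuousLinearMap.coe_coe]
      linarith)
  have hlP : ∀ x ∈ P, l x ≤ l v := by
    intro x hx
    have : P ⊆ {x | l x ≤ l v} := by
      rw [hS]
      refine convexHull_min (fun s hs => ?_) (convex_halfSpace_le l.isLinear _)
      have := hl (s - v) (Finset.mem_image_of_mem _ hs)
      rw [map_sub] at this
      exact sub_nonpos.1 this
    exact this hx
  refine ⟨LinearMap.toContinuousLinearMap l, hlP, hly, le_antisymm ?_ ?_⟩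
  · have hle : vectorSpan ℝ {x ∈ P | l x = l v} ≤ vectorSpan ℝ P :=
      vectorSpan_mono ℝ fun x hx => hx.1
    have hne : y ∉ vectorSpan ℝ {x ∈ P | l x = l v} := by
      intro h
      have : vectorSpan ℝ {x ∈ P | l x = l v} ≤ LinearMap.ker l := by
        rw [vectorSpan_def, Submodule.span_le]
        rintro _ ⟨a, ha, b, hb, rfl⟩
        simp [ha.2, hb.2]
      exact hly.ne' (this h)
    exact Submodule.finrank_lt_finrank_of_lt (lt_of_le_of_ne hle fun h => hne (h ▸ hy))
  · unfold polyDim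
    rw [hspan]
    refine hrank.trans (Nat.succ_le_succ (Submodule.finrank_mono ?_))
    rw [Submodule.span_le]
    rintro _ ⟨hx, hlx⟩
    obtain ⟨s, hs, rfl⟩ := Finset.mem_image.1 hx
    rw [map_sub, sub_eq_zero] at hlx
    exact vsub_mem_vectorSpan ℝ (show s ∈ {x ∈ P | l x = l v} from ⟨hSP s hs, hlx⟩) ⟨hvP, rfl⟩

end Polytope

/-! ### Local coordinates at a vertex. -/

section Frame

variable {E : Type*} [NormedAddCommGroup E] [NormedSpace ℝ E]

open Classical in
/-- The facets of `P` through `v`. -/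
noncomputable def facetsAt (P : Set E) [Fintype (polyFacets P)] (v : E) :
    Finset (polyFacets P) :=
  Finset.univ.filter fun F => v ∈ (F : Set E)

@[simp]
theorem mem_facetsAt {P : Set E} [Fintype (polyFacets P)] {v : E} {F : polyFacets P} :
    F ∈ facetsAt P v ↔ v ∈ (F : Set E) := by
  simp [facetsAt]

theorem IsSimplePolytope.card_facetsAt {n : ℕ} {P : Set E} [Fintype (polyFacets P)]
    (hP : IsSimplePolytope n P) {v : E} (hv : v ∈ P.extremePoints ℝ) :
    (facetsAt P v).card = n := by
  rw [← hP.ncard_facets v hv, ← Set.ncard_coe_finset,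
    ← Set.ncard_image_of_injective _ Subtype.val_injective]
  congr 1
  ext F
  simp [and_comm]

/-- Local coordinates of `P` at the vertex `v`: the coordinate functionals `t F` of the facets
through `v`, nonnegative on `P - v`, and the dual edge directions `e F`. -/
structure IsVertexFrame (P : Set E) [Fintype (polyFacets P)] (v : E)
    (t : polyFacets P → E →L[ℝ] ℝ) (e : polyFacets P → E) : Prop where
  mem : v ∈ P
  nonneg : ∀ F ∈ facetsAt P v, ∀ x ∈ P, 0 ≤ t F (x - v)
  mem_iff : ∀ F ∈ facetsAt P v, ∀ x ∈ P, x ∈ (F : Set E) ↔ t F (x - v) = 0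
  dir_mem : ∀ F ∈ facetsAt P v, e F ∈ vectorSpan ℝ P
  apply_self : ∀ F ∈ facetsAt P v, t F (e F) = 1
  apply_of_ne : ∀ F ∈ facetsAt P v, ∀ G ∈ facetsAt P v, G ≠ F → t G (e F) = 0
  eq_sum : ∀ y ∈ vectorSpan ℝ P, y = ∑ F ∈ facetsAt P v, t F y • e F
  exists_mem : ∀ y ∈ vectorSpan ℝ P, (∀ F ∈ facetsAt P v, 0 ≤ t F y) →
    ∃ ε : ℝ, 0 < ε ∧ v + ε • y ∈ P

/-- Two functionals that are maximal over `P` on the same facet have the same sign on the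
directions of `P`. -/
theorem pos_of_facet_eq {P : Set E} [FiniteDimensional ℝ E] {v : E} (hv : v ∈ P)
    {l l' : E →L[ℝ] ℝ} (hl : ∀ x ∈ P, l x ≤ l v) (hl' : ∀ x ∈ P, l' x ≤ l' v)
    (heq : {x ∈ P | l x = l v} = {x ∈ P | l' x = l' v})
    (hdim : polyDim {x ∈ P | l x = l v} + 1 = polyDim P) {y : E} (hy : y ∈ vectorSpan ℝ P)
    (hly : 0 < l y) : 0 < l' y := by
  set D := vectorSpan ℝ {x ∈ P | l x = l v} with hD
  obtain ⟨s, hs, hls⟩ : ∃ s ∈ P, l s < l v := by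
    by_contra! h
    have : {x ∈ P | l x = l v} = P := by
      ext x
      exact ⟨fun hx => hx.1, fun hx => ⟨hx, le_antisymm (hl x hx) (h x hx)⟩⟩
    rw [this] at hdim
    omega
  have hls' : l' s < l' v := by
    refine lt_of_le_of_ne (hl' s hs) fun h => hls.ne ?_
    have : s ∈ {x ∈ P | l' x = l' v} := ⟨hs, h⟩
    rw [← heq] at this
    exact this.2
  have hDl : ∀ d ∈ D, l d = 0 := by
    have : D ≤ LinearMap.ker (l : E →ₗ[ℝ] ℝ) := by
      rw [hD, vectorSpan_def, Submodule.span_le]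
      rintro _ ⟨a, ha, b, hb, rfl⟩
      simp [ha.2, hb.2]
    exact fun d hd => this hd
  have hDl' : ∀ d ∈ D, l' d = 0 := by
    have : D ≤ LinearMap.ker (l' : E →ₗ[ℝ] ℝ) := by
      rw [hD, heq, vectorSpan_def, Submodule.span_le]
      rintro _ ⟨a, ha, b, hb, rfl⟩
      simp [ha.2, hb.2]
    exact fun d hd => this hd
  -- Since `D` has corank one, `D` and `s - v` span all directions of `P`. Both functionals vanish
  -- on `D` and are negative at `s - v`, so their signs agree.
  have hsW : s - v ∈ vectorSpan ℝ P := vsub_mem_vectorSpan ℝ hs hv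
  have hle : D ⊔ Submodule.span ℝ {s - v} ≤ vectorSpan ℝ P :=
    sup_le (vectorSpan_mono ℝ fun x hx => hx.1) (by simpa using hsW)
  have hlt : D < D ⊔ Submodule.span ℝ {s - v} := by
    refine lt_of_le_of_ne le_sup_left fun h => ?_
    have h1 : s - v ∈ D := by
      rw [h]
      exact Submodule.mem_sup_right (Submodule.mem_span_singleton_self _)
    have := hDl _ h1
    rw [map_sub] at this
    linarith
  have heqW : D ⊔ Submodule.span ℝ {s - v} = vectorSpan ℝ P := by
    refine Submodule.eq_of_le_of_finrank_le hle ?_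
    have := Submodule.finrank_lt_finrank_of_lt hlt
    have hdim' : Module.finrank ℝ D + 1 = Module.finrank ℝ (vectorSpan ℝ P) := hdim
    omega
  rw [← heqW] at hy
  obtain ⟨d, hd, z, hz, rfl⟩ := Submodule.mem_sup.1 hy
  obtain ⟨a, rfl⟩ := Submodule.mem_span_singleton.1 hz
  simp only [map_add, map_smul, map_sub, smul_eq_mul, hDl d hd, hDl' d hd, zero_add] at hly ⊢
  have ha : a < 0 := by nlinarith
  nlinarith

/-- A direction on which all facet coordinates are nonnegative enters `P`, since otherwise some
facet through `v` would separate it. Extremality of `v` then makes the coordinate map injective;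
simplicity equates the number of coordinates with the dimension, so the map is bijective and has a
dual basis. -/
theorem IsSimplePolytope.exists_isVertexFrame {n : ℕ} {P : Set E} [Fintype (polyFacets P)]
    [FiniteDimensional ℝ E] (hP : IsSimplePolytope n P) {v : E} (hv : v ∈ P.extremePoints ℝ) :
    ∃ t e, IsVertexFrame P v t e := by
  classical
  have hvP : v ∈ P := hv.1
  have hchoose : ∀ F : polyFacets P, ∃ t : E →L[ℝ] ℝ, F ∈ facetsAt P v →
      (∀ x ∈ P, 0 ≤ t (x - v)) ∧ ∀ x ∈ P, x ∈ (F : Set E) ↔ t (x - v) = 0 := by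
    intro F
    by_cases hF : F ∈ facetsAt P v
    · obtain ⟨l, hl, hlF⟩ := F.2.1.exists_functional (mem_facetsAt.1 hF)
      refine ⟨-l, fun _ => ⟨fun x hx => by simpa using hl x hx, fun x hx => ?_⟩⟩
      rw [hlF]
      have : x ∈ P ∧ l x = l v ↔ (-l) (x - v) = 0 := by
        simp only [hx, true_and, neg_apply, map_sub]
        constructor <;> intro h <;> linarith
      exact this
    · exact ⟨0, fun h => absurd h hF⟩
  choose t ht using hchoose
  have hexists : ∀ y ∈ vectorSpan ℝ P, (∀ F ∈ facetsAt P v, 0 ≤ t F y) →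
      ∃ ε : ℝ, 0 < ε ∧ v + ε • y ∈ P := by
    intro y hy hty
    by_contra! hout
    obtain ⟨l, hl, hly, hdim⟩ := exists_facet_functional_pos hP.isConvexPolytope hv hy hout
    have hF : {x ∈ P | l x = l v} ∈ polyFacets P := by
      refine ⟨isPolyFace_setOf_eq hvP l hl, ?_⟩
      rw [← hdim]; push_cast; ring
    have hFv : (⟨_, hF⟩ : polyFacets P) ∈ facetsAt P v := mem_facetsAt.2 ⟨hvP, rfl⟩
    obtain ⟨h1, h2⟩ := ht _ hFv
    have := pos_of_facet_eq (l' := -t ⟨_, hF⟩) hvP hl (fun x hx => by simpa using h1 x hx) (by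
      ext x
      have := h2 x
      simp only [Set.mem_ofPred_eq] at this
      simp only [Set.mem_ofPred_eq]
      refine and_congr_right fun hx => ?_
      have := this hx
      simp only [hx, true_and] at this
      rw [this]
      simp [sub_eq_zero]) hdim hy hly
    have h3 := hty _ hFv
    simp only [neg_apply] at this
    linarith
  -- the coordinate map is injective on the direction space because `v` is extreme
  set Φ : vectorSpan ℝ P →ₗ[ℝ] (facetsAt P v → ℝ) :=
    LinearMap.pi fun F => (t F.1 : E →ₗ[ℝ] ℝ).domRestrict (vectorSpan ℝ P) with hΦ
  have hinj : Function.Injective Φ := by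
    rw [← LinearMap.ker_eq_bot, LinearMap.ker_eq_bot']
    rintro ⟨y, hy⟩ hy0
    have hy0' : ∀ F ∈ facetsAt P v, t F y = 0 := fun F hF => congrFun hy0 ⟨F, hF⟩
    obtain ⟨ε, hε, h1⟩ := hexists y hy fun F hF => (hy0' F hF).ge
    obtain ⟨δ, hδ, h2⟩ := hexists (-y) (Submodule.neg_mem _ hy) fun F hF => by simp [hy0' F hF]
    -- These weights exhibit `v` as an interior point of the segment from `v + ε • y` to `v - δ •
    -- y`.
    have := hv.2 h1 h2 ⟨δ / (ε + δ), ε / (ε + δ), by positivity, by positivity,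
      by field_simp; ring, by
        have hne : ε + δ ≠ 0 := by positivity
        rw [smul_add, smul_add, add_add_add_comm, ← add_smul, ← add_div, add_comm δ,
          div_self hne, one_smul, smul_neg, smul_neg, smul_smul, smul_smul]
        rw [show δ / (ε + δ) * ε = ε / (ε + δ) * δ by ring]
        simp⟩
    have hz : ε • y = 0 := by simpa using this
    simpa [hε.ne'] using hz
  have hrank : Module.finrank ℝ (vectorSpan ℝ P) = Module.finrank ℝ (facetsAt P v → ℝ) := by
    rw [Module.finrank_fintype_fun_eq_card, Fintype.card_coe, hP.card_facetsAt hv]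
    exact hP.polyDim_eq
  have hsurj : Function.Surjective Φ :=
    (LinearMap.injective_iff_surjective_of_finrank_eq_finrank hrank).1 hinj
  have hdual : ∀ F : polyFacets P, ∃ e : E, e ∈ vectorSpan ℝ P ∧ ∀ G ∈ facetsAt P v,
      t G e = if G = F then 1 else 0 := by
    intro F
    obtain ⟨y, hy⟩ := hsurj fun G => if G.1 = F then 1 else 0
    exact ⟨y, y.2, fun G hG => congrFun hy ⟨G, hG⟩⟩
  choose e he hte using hdual
  refine ⟨t, e, hvP, fun F hF => (ht F hF).1, fun F hF => (ht F hF).2, fun F _ => he F,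
    fun F hF => by simp [hte F F hF], fun F _ G hG hne => by simp [hte F G hG, hne], ?_, hexists⟩
  intro y hy
  have hsum : ∑ F ∈ facetsAt P v, t F y • e F ∈ vectorSpan ℝ P :=
    Submodule.sum_mem _ fun F _ => Submodule.smul_mem _ _ (he F)
  have : Φ ⟨y, hy⟩ = Φ ⟨_, hsum⟩ := by
    ext G
    simp only [hΦ, LinearMap.pi_apply, LinearMap.domRestrict_apply, ContinuousLinearMap.coe_coe,
      map_sum, map_smul, smul_eq_mul]
    rw [Finset.sum_congr rfl fun F _ => by rw [hte F G.1 G.2]]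
    simp
  exact congrArg Subtype.val (hinj this)

end Frame

/-! ### Faces as intersections of facets, and edges at a vertex. -/

section Faces

variable {E : Type*} [NormedAddCommGroup E] [NormedSpace ℝ E]

/-- The points of `P` lying on all the facets of `A`. -/
def facetInter (P : Set E) (A : Finset (polyFacets P)) : Set E :=
  {x ∈ P | ∀ F ∈ A, x ∈ (F : Set E)}

theorem mem_facetInter_iff_subset {P : Set E} [Fintype (polyFacets P)]
    {A : Finset (polyFacets P)} {x : E} (hx : x ∈ P) :
    x ∈ facetInter P A ↔ A ⊆ facetsAt P x := by
  simp only [facetInter, Set.mem_ofPred_eq, hx, true_and, Finset.subset_iff, mem_facetsAt]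

namespace IsVertexFrame

variable {P : Set E} [Fintype (polyFacets P)] {v : E} {t : polyFacets P → E →L[ℝ] ℝ}
  {e : polyFacets P → E}

theorem apply_dir_nonneg (h : IsVertexFrame P v t e) {F G : polyFacets P}
    (hF : F ∈ facetsAt P v) (hG : G ∈ facetsAt P v) : 0 ≤ t G (e F) := by
  by_cases hGF : G = F
  · subst hGF
    rw [h.apply_self _ hG]
    exact zero_le_one
  · rw [h.apply_of_ne F hF G hG hGF]

theorem sub_eq_sum (h : IsVertexFrame P v t e) {x : E} (hx : x ∈ P) :
    x - v = ∑ F ∈ facetsAt P v, t F (x - v) • e F :=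
  h.eq_sum _ (vsub_mem_vectorSpan ℝ hx h.mem)

theorem apply_sub (h : IsVertexFrame P v t e) (l : E →L[ℝ] ℝ) {x : E} (hx : x ∈ P) :
    l (x - v) = ∑ F ∈ facetsAt P v, t F (x - v) * l (e F) := by
  conv_lhs => rw [h.sub_eq_sum hx]
  simp

theorem exists_dir_mem (h : IsVertexFrame P v t e) {F : polyFacets P}
    (hF : F ∈ facetsAt P v) {A : Finset (polyFacets P)} (hA : A ⊆ facetsAt P v) (hFA : F ∉ A) :
    ∃ ε : ℝ, 0 < ε ∧ v + ε • e F ∈ facetInter P A := by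
  obtain ⟨ε, hε, hmem⟩ := h.exists_mem (e F) (h.dir_mem F hF)
    fun G hG => h.apply_dir_nonneg hF hG
  refine ⟨ε, hε, hmem, fun G hG => ?_⟩
  rw [h.mem_iff G (hA hG) _ hmem]
  simp [h.apply_of_ne F hF G (hA hG) (fun hGF => hFA (hGF ▸ hG))]

/-- A functional maximal at `v` is nonpositive on every edge direction. Its face is where the
coordinates with strictly negative coefficient vanish. -/
theorem exists_eq_facetInter (h : IsVertexFrame P v t e) {f : Set E} (hf : IsPolyFace P f)
    (hv : v ∈ f) : ∃ A ⊆ facetsAt P v, f = facetInter P A := by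
  classical
  obtain ⟨l, hl, rfl⟩ := hf.exists_functional hv
  have hle : ∀ F ∈ facetsAt P v, l (e F) ≤ 0 := by
    intro F hF
    obtain ⟨ε, hε, hmem⟩ := h.exists_dir_mem hF (Finset.empty_subset _) (Finset.notMem_empty F)
    have := hl _ hmem.1
    rw [map_add, map_smul, smul_eq_mul] at this
    nlinarith
  refine ⟨(facetsAt P v).filter fun F => l (e F) < 0, Finset.filter_subset _ _, ?_⟩
  ext x
  simp only [facetInter, Set.mem_ofPred_eq, Finset.mem_filter]
  refine and_congr_right fun hx => ?_
  rw [← sub_eq_zero, ← map_sub, h.apply_sub l hx, Finset.sum_eq_zero_iff_of_nonpos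
    fun F hF => mul_nonpos_of_nonneg_of_nonpos (h.nonneg F hF x hx) (hle F hF)]
  refine ⟨fun H F hF => ?_, fun H F hF => ?_⟩
  · rw [h.mem_iff F hF.1 x hx]
    exact (mul_eq_zero.1 (H F hF.1)).resolve_right hF.2.ne
  · rcases (hle F hF).lt_or_eq with h' | h'
    · rw [(h.mem_iff F hF x hx).1 (H F ⟨hF, h'⟩), zero_mul]
    · rw [h', mul_zero]

/-- The exposing functional is minus the sum of the coordinates in `A`: a sum of nonnegative terms
vanishes only termwise. -/
theorem isPolyFace_facetInter (h : IsVertexFrame P v t e) {A : Finset (polyFacets P)}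
    (hA : A ⊆ facetsAt P v) : IsPolyFace P (facetInter P A) := by
  have hle : ∀ x ∈ P, 0 ≤ ∑ F ∈ A, t F (x - v) := fun x hx =>
    Finset.sum_nonneg fun F hF => h.nonneg F (hA hF) x hx
  have := isPolyFace_setOf_eq h.mem (-∑ F ∈ A, t F) fun x hx => by
    have := hle x hx
    simp only [map_sub, Finset.sum_sub_distrib] at this
    simp only [neg_apply, sum_apply]
    linarith
  convert this using 1
  ext x
  simp only [facetInter, Set.mem_ofPred_eq]
  refine and_congr_right fun hx => ?_
  have h0 := Finset.sum_eq_zero_iff_of_nonneg fun F hF => h.nonneg F (hA hF) x hx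
  simp only [neg_apply, sum_apply]
  rw [neg_inj, ← sub_eq_zero, ← Finset.sum_sub_distrib]
  simp only [← map_sub]
  rw [h0]
  exact forall₂_congr fun F hF => h.mem_iff F (hA hF) x hx

theorem vectorSpan_facetInter (h : IsVertexFrame P v t e) {A : Finset (polyFacets P)}
    (hA : A ⊆ facetsAt P v) [DecidableEq (polyFacets P)] :
    vectorSpan ℝ (facetInter P A) = Submodule.span ℝ (e '' (facetsAt P v \ A : Finset _)) := by
  have hvA : v ∈ facetInter P A := (mem_facetInter_iff_subset h.mem).2 hA
  refine le_antisymm ?_ (Submodule.span_le.2 ?_)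
  · rw [vectorSpan_eq_span_vsub_set_right ℝ hvA, Submodule.span_le]
    rintro _ ⟨x, hx, rfl⟩
    have hsum := h.sub_eq_sum hx.1
    change x - v ∈ Submodule.span ℝ _
    rw [hsum]
    refine Submodule.sum_mem _ fun F hF => ?_
    by_cases hFA : F ∈ A
    · rw [(h.mem_iff F hF x hx.1).1 (hx.2 F hFA), zero_smul]
      exact Submodule.zero_mem _
    · exact Submodule.smul_mem _ _ (Submodule.subset_span ⟨F, by simpa [hFA] using hF, rfl⟩)
  · rintro _ ⟨F, hF, rfl⟩
    rw [Finset.mem_coe, Finset.mem_sdiff] at hF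
    obtain ⟨ε, hε, hmem⟩ := h.exists_dir_mem hF.1 hA hF.2
    have := vsub_mem_vectorSpan ℝ hmem hvA
    rw [vsub_eq_sub, add_sub_cancel_left] at this
    exact (Submodule.smul_mem_iff _ hε.ne').1 this

theorem linearIndepOn_dir (h : IsVertexFrame P v t e) :
    LinearIndepOn ℝ e (facetsAt P v : Set (polyFacets P)) := by
  rw [linearIndepOn_finset_iff]
  intro g hg F hF
  have := congrArg (t F) hg
  rw [map_sum, map_zero, Finset.sum_eq_single_of_mem F hF] at this
  · simpa [h.apply_self F hF] using this
  · intro G hG hGF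
    simp [h.apply_of_ne G hG F hF hGF.symm]

theorem polyDim_facetInter (h : IsVertexFrame P v t e) {A : Finset (polyFacets P)}
    (hA : A ⊆ facetsAt P v) :
    polyDim (facetInter P A) + A.card = (facetsAt P v).card := by
  classical
  have hli : LinearIndepOn ℝ e ((facetsAt P v \ A : Finset _) : Set (polyFacets P)) :=
    h.linearIndepOn_dir.mono (by simp)
  have : polyDim (facetInter P A) = (facetsAt P v \ A).card := by
    unfold polyDim
    rw [h.vectorSpan_facetInter hA, Set.image_eq_range]
    exact (finrank_span_eq_card hli).trans (Fintype.card_coe _)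
  rw [this, Finset.card_sdiff_add_card_eq_card hA]

theorem eq_add_smul_dir (h : IsVertexFrame P v t e) [DecidableEq (polyFacets P)]
    {F : polyFacets P} (hF : F ∈ facetsAt P v) {x : E}
    (hx : x ∈ facetInter P ((facetsAt P v).erase F)) : x = v + t F (x - v) • e F := by
  have hsum := h.sub_eq_sum hx.1
  rw [Finset.sum_eq_single_of_mem F hF] at hsum
  · rw [← hsum, add_sub_cancel]
  · intro G hG hGF
    rw [(h.mem_iff G hG x hx.1).1 (hx.2 G (Finset.mem_erase.2 ⟨hGF, hG⟩)), zero_smul]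

theorem apply_pos_of_ne (h : IsVertexFrame P v t e) [DecidableEq (polyFacets P)]
    {F : polyFacets P} (hF : F ∈ facetsAt P v) {x : E}
    (hx : x ∈ facetInter P ((facetsAt P v).erase F)) (hxv : x ≠ v) : 0 < t F (x - v) := by
  refine lt_of_le_of_ne (h.nonneg F hF x hx.1) fun h0 => hxv ?_
  rw [h.eq_add_smul_dir hF hx, ← h0, zero_smul, add_zero]

theorem exists_adjacent (h : IsVertexFrame P v t e) (hP : IsConvexPolytope P)
    [DecidableEq (polyFacets P)] {F : polyFacets P} (hF : F ∈ facetsAt P v) :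
    ∃ u ∈ P.extremePoints ℝ, u ≠ v ∧ u ∈ facetInter P ((facetsAt P v).erase F) := by
  by_contra! hno
  have hface := h.isPolyFace_facetInter (Finset.erase_subset F (facetsAt P v))
  have hsub : facetInter P ((facetsAt P v).erase F) ⊆ {v} := by
    rw [hface.eq_closure hP]
    refine closure_minimal (convexHull_min ?_ (convex_singleton v)) isClosed_singleton
    rintro u ⟨hu, hu'⟩
    by_contra huv
    exact hno u hu' huv hu
  obtain ⟨ε, hε, hmem⟩ := h.exists_dir_mem hF (Finset.erase_subset F (facetsAt P v))
    (Finset.notMem_erase F _)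
  have h0 : ε • e F = 0 := by simpa using hsub hmem
  have := h.apply_self F hF
  rw [(smul_eq_zero.1 h0).resolve_left hε.ne', map_zero] at this
  exact zero_ne_one this

/-- All candidates lie on one ray from `v`; the nearer of two distinct ones would be interior to a
segment of `P`. -/
theorem adjacent_unique (h : IsVertexFrame P v t e)
    [DecidableEq (polyFacets P)] {F : polyFacets P} (hF : F ∈ facetsAt P v) {u w : E}
    (hu : u ∈ P.extremePoints ℝ) (huv : u ≠ v) (huF : u ∈ facetInter P ((facetsAt P v).erase F))
    (hw : w ∈ P.extremePoints ℝ) (hwv : w ≠ v) (hwF : w ∈ facetInter P ((facetsAt P v).erase F)) :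
    u = w := by
  have key : ∀ u ∈ P.extremePoints ℝ, u ≠ v → u ∈ facetInter P ((facetsAt P v).erase F) →
      ∀ w ∈ P.extremePoints ℝ, w ≠ v → w ∈ facetInter P ((facetsAt P v).erase F) →
      t F (w - v) ≤ t F (u - v) := by
    intro u hu huv huF w hw hwv hwF
    by_contra! hlt
    have hu0 := h.apply_pos_of_ne hF huF huv
    have hw0 := h.apply_pos_of_ne hF hwF hwv
    refine huv (hu.2 h.mem hwF.1 ⟨1 - t F (u - v) / t F (w - v), t F (u - v) / t F (w - v),
      sub_pos.2 ((div_lt_one hw0).2 hlt), div_pos hu0 hw0, by ring, ?_⟩).symm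
    conv_rhs => rw [h.eq_add_smul_dir hF huF]
    conv_lhs => enter [2, 2]; rw [h.eq_add_smul_dir hF hwF]
    rw [smul_add, smul_smul, div_mul_cancel₀ _ hw0.ne', ← add_assoc, ← add_smul]
    simp
  rw [h.eq_add_smul_dir hF huF, h.eq_add_smul_dir hF hwF,
    le_antisymm (key w hw hwv hwF u hu huv huF) (key u hu huv huF w hw hwv hwF)]

/-- The simplex-method step: expand `w - v` in edge directions; some term must decrease `l`.
Coordinates of `w` in `A` vanish, so the facet dropped is not in `A`. -/
theorem exists_descent (h : IsVertexFrame P v t e) (hP : IsConvexPolytope P)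
    [DecidableEq (polyFacets P)] (l : E →L[ℝ] ℝ) {A : Finset (polyFacets P)} {w : E}
    (hw : w ∈ facetInter P A) (hlt : l w < l v) :
    ∃ F ∈ facetsAt P v \ A, ∃ u ∈ P.extremePoints ℝ,
      u ∈ facetInter P ((facetsAt P v).erase F) ∧ l u < l v := by
  have hsum := h.apply_sub l hw.1
  obtain ⟨F, hF, hF0⟩ : ∃ F ∈ facetsAt P v, t F (w - v) * l (e F) < 0 := by
    by_contra! H
    have := Finset.sum_nonneg H
    rw [← hsum, map_sub] at this
    linarith
  have hlF : l (e F) < 0 := by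
    by_contra! H
    exact absurd (mul_nonneg (h.nonneg F hF w hw.1) H) (not_le.2 hF0)
  have hFA : F ∉ A := by
    intro hFA
    rw [(h.mem_iff F hF w hw.1).1 (hw.2 F hFA), zero_mul] at hF0
    exact lt_irrefl _ hF0
  obtain ⟨u, hu, huv, huF⟩ := h.exists_adjacent hP hF
  refine ⟨F, Finset.mem_sdiff.2 ⟨hF, hFA⟩, u, hu, huF, ?_⟩
  have := h.apply_pos_of_ne hF huF huv
  rw [h.eq_add_smul_dir hF huF, map_add, map_smul, smul_eq_mul]
  nlinarith

end IsVertexFrame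

theorem IsSimplePolytope.isCodimFace_iff {n : ℕ} {P : Set E} [Fintype (polyFacets P)]
    [FiniteDimensional ℝ E] (hP : IsSimplePolytope n P) (k : ℕ) (f : Set E) :
    IsCodimFace P k f ↔ ∃ v ∈ P.extremePoints ℝ, ∃ A ⊆ facetsAt P v,
      A.card = k ∧ f = facetInter P A := by
  constructor
  · rintro ⟨hf, hdim⟩
    obtain ⟨v, hv, hvf⟩ := hf.exists_vertex hP.isConvexPolytope
    obtain ⟨t, e, h⟩ := hP.exists_isVertexFrame hv
    obtain ⟨A, hA, rfl⟩ := h.exists_eq_facetInter hf hvf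
    refine ⟨v, hv, A, hA, ?_, rfl⟩
    have := h.polyDim_facetInter hA
    rw [hP.card_facetsAt hv] at this
    rw [hP.polyDim_eq] at hdim
    omega
  · rintro ⟨v, hv, A, hA, hk, rfl⟩
    obtain ⟨t, e, h⟩ := hP.exists_isVertexFrame hv
    refine ⟨h.isPolyFace_facetInter hA, ?_⟩
    have := h.polyDim_facetInter hA
    rw [hP.card_facetsAt hv] at this
    rw [hP.polyDim_eq]
    omega

end Faces

/-! ### Colourings and codes from the vertex–facet incidences alone. -/

section Incidence

/-- The incidences between vertices and facets of a simple polytope of dimension `n`, with a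
generic height function `h` on the vertices. -/
structure IsSimpleIncidence {V Φ : Type*} [DecidableEq Φ] (n : ℕ) (I : V → Finset Φ)
    (h : V → ℝ) : Prop where
  nonempty : Nonempty V
  card_eq : ∀ v, (I v).card = n
  exists_mem : ∀ F, ∃ v, F ∈ I v
  exists_adjacent : ∀ v, ∀ F ∈ I v, ∃ u, u ≠ v ∧ (I v).erase F ⊆ I u ∧
    ∀ w, w ≠ v → (I v).erase F ⊆ I w → w = u
  injective : Function.Injective h
  descent : ∀ (A : Finset Φ) (v w : V), A ⊆ I w → h w < h v →
    ∃ F ∈ I v \ A, ∃ u, (I v).erase F ⊆ I u ∧ h u < h v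
  ascent : ∀ (A : Finset Φ) (v w : V), A ⊆ I w → h v < h w →
    ∃ F ∈ I v \ A, ∃ u, (I v).erase F ⊆ I u ∧ h v < h u

/-- A colouring with `n` colours in which facets meeting at a vertex have different colours. -/
def IsVertexProper {V Φ : Type*} {n : ℕ} (I : V → Finset Φ) (c : Φ → Fin n) : Prop :=
  ∀ v, Set.InjOn c (I v : Set Φ)

/-- The indicator vector of the vertices that lie on all the facets of `A`. -/
def interVector {V Φ : Type*} [DecidableEq Φ] (I : V → Finset Φ) (A : Finset Φ) : V → ZMod 2 :=
  fun v => if A ⊆ I v then 1 else 0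

/-- The span of the indicator vectors of the faces that are intersections of `k` facets. -/
def incidenceCode {V Φ : Type*} [DecidableEq Φ] (I : V → Finset Φ) (k : ℕ) :
    Submodule (ZMod 2) (V → ZMod 2) :=
  Submodule.span (ZMod 2) {x | ∃ v, ∃ A ⊆ I v, A.card = k ∧ x = interVector I A}

namespace IsSimpleIncidence

variable {V Φ : Type*} [DecidableEq Φ] {n : ℕ} {I : V → Finset Φ} {h : V → ℝ}

/-- For `A = I v` no facet is left to drop, so `w` can be neither lower nor higher than `v`. -/
theorem eq_of_subset (H : IsSimpleIncidence n I h) {v w : V} (hvw : I v ⊆ I w) : w = v := by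
  by_contra hne
  rcases lt_or_gt_of_ne (fun heq => hne (H.injective heq) : h w ≠ h v) with hlt | hlt
  · obtain ⟨F, hF, -⟩ := H.descent (I v) v w hvw hlt
    simp at hF
  · obtain ⟨F, hF, -⟩ := H.ascent (I v) v w hvw hlt
    simp at hF

theorem card_edge [Fintype V] (H : IsSimpleIncidence n I h) {B : Finset Φ} {w : V}
    (hB : B ⊆ I w) (hcard : B.card + 1 = n) :
    (Finset.univ.filter fun x => B ⊆ I x).card = 2 := by
  classical
  have h1 : (I w \ B).card = 1 := by
    rw [Finset.card_sdiff_of_subset hB, H.card_eq]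
    omega
  obtain ⟨G, hG⟩ := Finset.card_eq_one.1 h1
  have hBG : B = (I w).erase G := by
    rw [Finset.erase_eq, ← hG, Finset.sdiff_sdiff_eq_self hB]
  have hGw : G ∈ I w := by
    have : G ∈ I w \ B := by simp [hG]
    exact (Finset.mem_sdiff.1 this).1
  obtain ⟨u, huw, hu, huniq⟩ := H.exists_adjacent w G hGw
  rw [← Finset.card_pair huw.symm]
  congr 1
  ext x
  simp only [Finset.mem_filter, Finset.mem_univ, true_and, Finset.mem_insert,
    Finset.mem_singleton]
  constructor
  · intro hx
    by_cases hxw : x = w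
    · exact Or.inl hxw
    · exact Or.inr (huniq x hxw (hBG ▸ hx))
  · rintro (rfl | rfl)
    · exact hB
    · exact hBG ▸ hu

/-- The sum of all coordinates kills every edge vector, hence the vector of every 2-face as well. -/
theorem even_card_of_code_le [Fintype V] (H : IsSimpleIncidence n I h) {k : ℕ} (hk : k + 2 = n)
    (hle : incidenceCode I k ≤ incidenceCode I (k + 1)) {v : V} {A : Finset Φ} (hA : A ⊆ I v)
    (hcard : A.card = k) : Even (Finset.univ.filter fun x => A ⊆ I x).card := by
  set s : (V → ZMod 2) →ₗ[ZMod 2] ZMod 2 := ∑ x, LinearMap.proj x with hs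
  have hsum : ∀ B : Finset Φ,
      s (interVector I B) = ((Finset.univ.filter fun x => B ⊆ I x).card : ZMod 2) := by
    intro B
    simp [hs, interVector]
  have hker : incidenceCode I (k + 1) ≤ LinearMap.ker s := by
    refine Submodule.span_le.2 ?_
    rintro _ ⟨w, B, hB, hBk, rfl⟩
    rw [SetLike.mem_coe, LinearMap.mem_ker, hsum, H.card_edge hB (by omega)]
    rfl
  have := hker (hle (Submodule.subset_span ⟨v, A, hA, hcard, rfl⟩))
  rw [LinearMap.mem_ker, hsum] at this
  exact (ZMod.natCast_eq_zero_iff_even).1 this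

theorem exists_unique_color (H : IsSimpleIncidence n I h) {c : Φ → Fin n} {v : V}
    (hc : Set.InjOn c (I v : Set Φ)) (i : Fin n) : ∃ F ∈ I v, c F = i := by
  classical
  have : (I v).image c = Finset.univ := by
    rw [← Finset.card_eq_iff_eq_univ, Finset.card_image_of_injOn hc, H.card_eq, Fintype.card_fin]
  have hi : i ∈ (I v).image c := this ▸ Finset.mem_univ i
  simpa using hi

theorem card_filter_color (H : IsSimpleIncidence n I h) {c : Φ → Fin n} {v : V}
    (hc : Set.InjOn c (I v : Set Φ)) (i : Fin n) : ((I v).filter fun F => c F = i).card = 1 := by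
  obtain ⟨F, hF, hFi⟩ := H.exists_unique_color hc i
  rw [Finset.card_eq_one]
  refine ⟨F, ?_⟩
  ext G
  simp only [Finset.mem_filter, Finset.mem_singleton]
  constructor
  · rintro ⟨hG, hGi⟩
    exact hc hG hF (hGi.trans hFi.symm)
  · rintro rfl
    exact ⟨hF, hFi⟩

/-- In a two-dimensional face with an even number of vertices, a colouring that is proper away
from one vertex is proper there too. -/
theorem color_ne_of_even [Fintype V] [Fintype Φ] (H : IsSimpleIncidence n I h) {c : Φ → Fin n}
    {v : V} {F₁ F₂ : Φ} (h₁ : F₁ ∈ I v) (h₂ : F₂ ∈ I v) (hne : F₁ ≠ F₂)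
    (heven : Even (Finset.univ.filter fun x => ((I v).erase F₁).erase F₂ ⊆ I x).card)
    (hc : ∀ w, w ≠ v → ((I v).erase F₁).erase F₂ ⊆ I w → Set.InjOn c (I w : Set Φ)) :
    c F₁ ≠ c F₂ := by
  classical
  intro hcol
  set A := ((I v).erase F₁).erase F₂ with hA
  have h₂' : F₂ ∈ (I v).erase F₁ := Finset.mem_erase.2 ⟨hne.symm, h₂⟩
  have hAcard : A.card + 2 = n := by
    rw [← H.card_eq v, ← Finset.card_erase_add_one h₁, ← Finset.card_erase_add_one h₂']
  have hAv : A ⊆ I v := (Finset.erase_subset _ _).trans (Finset.erase_subset _ _)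
  obtain ⟨u, huv, hu, -⟩ := H.exists_adjacent v F₁ h₁
  have hAx : ∀ G ∈ A, c G ≠ c F₂ := by
    intro G hG hGc
    have := hc u huv ((Finset.erase_subset _ _).trans hu)
      (hu (Finset.mem_of_mem_erase hG)) (hu h₂') hGc
    exact Finset.ne_of_mem_erase hG this
  set S := Finset.univ.filter fun x => A ⊆ I x with hS
  set X := Finset.univ.filter fun G : Φ => c G = c F₂ ∧ G ∉ A with hX
  -- Count incidences of vertices of the 2-face with facets of colour `c F₂` outside `A`. By
  -- vertices: two at `v`, one at each other vertex, an odd total. By facets: each meets the 2-face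
  -- in an edge or in no vertex, an even total.
  have hcount := Finset.sum_card_bipartiteAbove_eq_sum_card_bipartiteBelow
    (fun (w : V) (G : Φ) => G ∈ I w) (s := S) (t := X)
  have hvS : v ∈ S := by simp [hS, hAv]
  have habove : ∀ w ∈ S.erase v,
      (Finset.bipartiteAbove (fun (w : V) (G : Φ) => G ∈ I w) X w).card = 1 := by
    intro w hw
    rw [Finset.mem_erase, hS, Finset.mem_filter] at hw
    rw [← H.card_filter_color (hc w hw.1 hw.2.2) (c F₂)]
    congr 1
    ext G
    simp only [Finset.bipartiteAbove, hX, Finset.mem_filter, Finset.mem_univ, true_and]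
    constructor
    · rintro ⟨⟨h1, -⟩, h2⟩
      exact ⟨h2, h1⟩
    · rintro ⟨h1, h2⟩
      exact ⟨⟨h2, fun hG => hAx G hG h2⟩, h1⟩
  have habove_v : (Finset.bipartiteAbove (fun (w : V) (G : Φ) => G ∈ I w) X v).card = 2 := by
    rw [← Finset.card_pair hne]
    congr 1
    ext G
    simp only [Finset.bipartiteAbove, hX, hA, Finset.mem_filter, Finset.mem_univ, true_and,
      Finset.mem_erase, Finset.mem_insert, Finset.mem_singleton]
    constructor
    · rintro ⟨⟨-, h1⟩, h2⟩
      tauto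
    · rintro (rfl | rfl)
      · exact ⟨⟨hcol, by tauto⟩, h₁⟩
      · exact ⟨⟨rfl, by tauto⟩, h₂⟩
  have hbelow : ∀ G ∈ X,
      Even (Finset.bipartiteBelow (fun (w : V) (G : Φ) => G ∈ I w) S G).card := by
    intro G hG
    have heq : Finset.bipartiteBelow (fun (w : V) (G : Φ) => G ∈ I w) S G =
        Finset.univ.filter fun x => insert G A ⊆ I x := by
      ext x
      simp [Finset.bipartiteBelow, hS, Finset.insert_subset_iff, and_comm]
    rw [heq]
    rcases Finset.eq_empty_or_nonempty (Finset.univ.filter fun x => insert G A ⊆ I x) with h0 | h0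
    · simp [h0]
    · obtain ⟨w, hw⟩ := h0
      rw [H.card_edge (Finset.mem_filter.1 hw).2]
      · exact even_two
      · rw [Finset.card_insert_of_notMem (Finset.mem_filter.1 hG).2.2]
        omega
  rw [← Finset.add_sum_erase _ _ hvS, Finset.sum_congr rfl habove, habove_v,
    Finset.sum_const, smul_eq_mul, mul_one] at hcount
  have hSc := Finset.card_erase_add_one hvS
  have he := Finset.even_sum _ hbelow
  rw [← hcount] at he
  rw [← hSc] at heven
  obtain ⟨a, ha⟩ := he
  obtain ⟨b, hb⟩ := heven
  omega

/-- Induction on sets of vertices closed downwards in height, with `v` the top vertex. If a single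
edge at `v` descends, the facet it leaves is new and may take the missing colour. If several
descend, the old colouring already works: two facets at `v` either share a lower neighbour of `v` or
span a 2-face with top `v`, where parity applies. -/
theorem exists_proper_on_lower [Fintype V] [Fintype Φ] (H : IsSimpleIncidence n I h)
    (hn : 0 < n)
    (heven : ∀ v, ∀ A ⊆ I v, A.card + 2 = n → Even (Finset.univ.filter fun x => A ⊆ I x).card)
    (k : ℕ) : ∀ D : Finset V, D.card = k → (∀ v ∈ D, ∀ w, h w < h v → w ∈ D) →
      ∃ c : Φ → Fin n, ∀ v ∈ D, Set.InjOn c (I v : Set Φ) := by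
  classical
  induction k with
  | zero =>
    intro D hD _
    rw [Finset.card_eq_zero] at hD
    exact ⟨fun _ => ⟨0, hn⟩, by simp [hD]⟩
  | succ k ih =>
    intro D hD hlow
    obtain ⟨v, hv, hmax⟩ := D.exists_max_image h (Finset.card_pos.1 (by omega))
    have hlt : ∀ w ∈ D, w ≠ v → h w < h v := fun w hw hwv =>
      lt_of_le_of_ne (hmax w hw) fun heq => hwv (H.injective heq)
    obtain ⟨c, hc⟩ := ih (D.erase v) (by rw [Finset.card_erase_of_mem hv]; omega) (by
      intro u hu w hw
      rw [Finset.mem_erase] at hu ⊢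
      refine ⟨?_, hlow u hu.2 w hw⟩
      rintro rfl
      exact absurd (hmax u hu.2) (not_le.2 hw))
    have hc' : ∀ w, h w < h v → Set.InjOn c (I w : Set Φ) := fun w hw =>
      hc w (Finset.mem_erase.2 ⟨fun heq => hw.ne (heq ▸ rfl), hlow v hv w hw⟩)
    by_cases htwo : ∃ F ∈ I v, ∃ u, (I v).erase F ⊆ I u ∧ h u < h v
    swap
    · -- `v` is the lowest vertex
      have hDv : ∀ w ∈ D, w = v := by
        intro w hw
        by_contra hwv
        obtain ⟨F, hF, hu⟩ := H.descent ∅ v w (Finset.empty_subset _) (hlt w hw hwv)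
        exact htwo ⟨F, (Finset.mem_sdiff.1 hF).1, hu⟩
      refine ⟨fun F => if hF : F ∈ I v then (I v).equivFinOfCardEq (H.card_eq v) ⟨F, hF⟩
        else ⟨0, hn⟩, fun w hw => ?_⟩
      rw [hDv w hw]
      intro F hF G hG hFG
      rw [Finset.mem_coe] at hF hG
      simpa [hF, hG] using hFG
    obtain ⟨F, hF, u, hFu, hu⟩ := htwo
    have hinjF : Set.InjOn c ((I v).erase F : Set Φ) :=
      (hc' u hu).mono (by exact_mod_cast hFu)
    by_cases hmore : ∃ G ∈ I v, G ≠ F ∧ ∃ w, (I v).erase G ⊆ I w ∧ h w < h v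
    · refine ⟨c, fun w hw => ?_⟩
      by_cases hwv : w = v
      swap
      · exact hc' w (hlt w hw hwv)
      subst hwv
      intro F₁ h₁ F₂ h₂ hcol
      by_contra hne
      by_cases hthird : ∃ K ∈ I w, K ≠ F₁ ∧ K ≠ F₂ ∧ ∃ u, (I w).erase K ⊆ I u ∧ h u < h w
      · obtain ⟨K, -, hK₁, hK₂, u, hKu, hu⟩ := hthird
        exact hne (hc' u hu (hKu (Finset.mem_erase.2 ⟨hK₁.symm, h₁⟩))
          (hKu (Finset.mem_erase.2 ⟨hK₂.symm, h₂⟩)) hcol)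
      · obtain ⟨G, hG, hGF, hGlow⟩ := hmore
        have hlower : ∀ K, K = F₁ ∨ K = F₂ → ∃ u, (I w).erase K ⊆ I u ∧ h u < h w := by
          have hF' : F = F₁ ∨ F = F₂ := by
            by_contra! hFF
            exact hthird ⟨F, hF, hFF.1, hFF.2, u, hFu, hu⟩
          have hG' : G = F₁ ∨ G = F₂ := by
            by_contra! hGG
            exact hthird ⟨G, hG, hGG.1, hGG.2, hGlow⟩
          intro K hK
          have : K = F ∨ K = G := by
            rcases hF' with rfl | rfl <;> rcases hG' with rfl | rfl <;> tauto
          rcases this with rfl | rfl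
          · exact ⟨u, hFu, hu⟩
          · exact hGlow
        have h₂' : F₂ ∈ (I w).erase F₁ := Finset.mem_erase.2 ⟨fun heq => hne heq.symm, h₂⟩
        refine H.color_ne_of_even h₁ h₂ hne (heven w _
          ((Finset.erase_subset _ _).trans (Finset.erase_subset _ _)) ?_) (fun x hxw hx => ?_) hcol
        · rw [← H.card_eq w, ← Finset.card_erase_add_one h₁, ← Finset.card_erase_add_one h₂']
        · refine hc' x (lt_of_not_ge fun hge => ?_)
          obtain ⟨K, hK, u', hKu', hu'⟩ := H.ascent _ w x hx
            (lt_of_le_of_ne hge fun heq => hxw (H.injective heq.symm))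
          have hK' : K = F₁ ∨ K = F₂ := by
            simp only [Finset.mem_sdiff, Finset.mem_erase] at hK
            tauto
          obtain ⟨y, hKy, hy⟩ := hlower K hK'
          obtain ⟨z, -, -, hz⟩ := H.exists_adjacent w K (Finset.mem_sdiff.1 hK).1
          have h1 := hz y (fun heq => hy.ne (heq ▸ rfl)) hKy
          have h2 := hz u' (fun heq => hu'.ne (heq ▸ rfl)) hKu'
          rw [h1, ← h2] at hy
          exact lt_asymm hy hu'
    · -- `F` has no lower vertex, so it can be recoloured
      have hcard : (((I v).erase F).image c).card < (Finset.univ : Finset (Fin n)).card := by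
        rw [Finset.card_image_of_injOn hinjF, Finset.card_erase_of_mem hF, H.card_eq,
          Finset.card_fin]
        omega
      obtain ⟨i, -, hi⟩ := Finset.exists_mem_notMem_of_card_lt_card hcard
      refine ⟨Function.update c F i, fun w hw => ?_⟩
      by_cases hwv : w = v
      · subst hwv
        rw [← Finset.insert_erase hF, Finset.coe_insert,
          Set.injOn_insert (by simp)]
        have heq : Set.EqOn (Function.update c F i) c ((I w).erase F : Set Φ) := fun G hG =>
          Function.update_of_ne (Finset.ne_of_mem_erase hG) _ _
        refine ⟨hinjF.congr heq.symm, ?_⟩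
        rw [heq.image_eq, Function.update_self]
        rintro ⟨G, hG, hGi⟩
        exact hi (Finset.mem_image.2 ⟨G, hG, hGi⟩)
      · have hwlt := hlt w hw hwv
        have hFw : F ∉ I w := by
          intro hFw
          obtain ⟨G, hG, hGlow⟩ := H.descent {F} v w (Finset.singleton_subset_iff.2 hFw) hwlt
          rw [Finset.mem_sdiff, Finset.mem_singleton] at hG
          exact hmore ⟨G, hG.1, hG.2, hGlow⟩
        refine (hc' w hwlt).congr fun G hG => (Function.update_of_ne ?_ _ _).symm
        rintro rfl
        exact hFw hG

theorem exists_proper_of_code_le [Fintype V] [Fintype Φ] (H : IsSimpleIncidence n I h) {k : ℕ}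
    (hk : k + 2 = n) (hle : incidenceCode I k ≤ incidenceCode I (k + 1)) :
    ∃ c : Φ → Fin n, IsVertexProper I c := by
  obtain ⟨c, hc⟩ := H.exists_proper_on_lower (by omega)
    (fun v A hA hcard => H.even_card_of_code_le hk hle hA (by omega)) _ Finset.univ rfl
    fun _ _ _ _ => Finset.mem_univ _
  exact ⟨c, fun v => hc v (Finset.mem_univ v)⟩

theorem exists_proper_of_eq_one (H : IsSimpleIncidence n I h) (hn : n = 1) :
    ∃ c : Φ → Fin n, IsVertexProper I c := by
  subst hn
  exact ⟨fun _ => 0, fun v F hF G hG _ => Finset.card_le_one.1 (H.card_eq v).le F hF G hG⟩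

theorem code_le_of_proper [Fintype Φ] (H : IsSimpleIncidence n I h) {c : Φ → Fin n}
    (hc : IsVertexProper I c) {k : ℕ} (hk : k < n) :
    incidenceCode I k ≤ incidenceCode I (k + 1) := by
  classical
  refine Submodule.span_le.2 ?_
  rintro _ ⟨v, A, hA, rfl, rfl⟩
  obtain ⟨F₀, hF₀, hF₀A⟩ := Finset.exists_mem_notMem_of_card_lt_card (hk.trans_eq (H.card_eq v).symm)
  have hcol : ∀ F, c F = c F₀ → F ∉ A := fun F hF hFA =>
    hF₀A (hc v (hA hFA) hF₀ hF ▸ hFA)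
  -- The colour of `F₀` does not occur in `A`, and each vertex lies on exactly one facet of that
  -- colour, so these facets split the vertices of the face.
  have hsum : interVector I A =
      ∑ F ∈ Finset.univ.filter (fun F => c F = c F₀), interVector I (insert F A) := by
    ext w
    simp only [Finset.sum_apply, interVector, Finset.insert_subset_iff]
    by_cases hAw : A ⊆ I w
    · have := H.card_filter_color (hc w) (c F₀)
      simp only [hAw, and_true, if_true, Finset.sum_boole]
      rw [Finset.filter_filter]
      rw [show (Finset.univ.filter fun F => c F = c F₀ ∧ F ∈ I w) =
        (I w).filter fun F => c F = c F₀ by ext; simp [and_comm], this]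
      rfl
    · simp [hAw]
  rw [hsum]
  refine Submodule.sum_mem _ fun F hF => ?_
  by_cases hex : ∃ w, insert F A ⊆ I w
  · obtain ⟨w, hw⟩ := hex
    exact Submodule.subset_span ⟨w, _, hw,
      Finset.card_insert_of_notMem (hcol F (Finset.mem_filter.1 hF).2), rfl⟩
  · have : interVector I (insert F A) = 0 := by
      ext w
      simp only [interVector, Pi.zero_apply, ite_eq_right_iff]
      exact fun hw => absurd ⟨w, hw⟩ hex
    rw [this]
    exact Submodule.zero_mem _

theorem code_eq_top [Fintype V] (H : IsSimpleIncidence n I h) : incidenceCode I n = ⊤ := by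
  classical
  rw [eq_top_iff, ← (Pi.basisFun (ZMod 2) V).span_eq, Submodule.span_le]
  rintro _ ⟨v, rfl⟩
  refine Submodule.subset_span ⟨v, I v, subset_rfl, H.card_eq v, ?_⟩
  ext w
  rw [Pi.basisFun_apply, Pi.single_apply]
  unfold interVector
  refine if_congr ⟨?_, H.eq_of_subset⟩ rfl rfl
  rintro rfl
  exact subset_rfl

end IsSimpleIncidence

end Incidence

/-! ### Linear relations among facet vectors and the dimension of 𝔅₁. -/

section Rank

/-- The vectors over `𝔽₂` whose entries add up to zero. -/
def sumZero (ι : Type*) [Fintype ι] : Submodule (ZMod 2) (ι → ZMod 2) :=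
  LinearMap.ker (∑ i, LinearMap.proj i : (ι → ZMod 2) →ₗ[ZMod 2] ZMod 2)

theorem mem_sumZero {ι : Type*} [Fintype ι] {x : ι → ZMod 2} :
    x ∈ sumZero ι ↔ ∑ i, x i = 0 := by
  simp [sumZero]

theorem finrank_sumZero (ι : Type*) [Fintype ι] [Nonempty ι] :
    Module.finrank (ZMod 2) (sumZero ι) + 1 = Fintype.card ι := by
  classical
  set s : (ι → ZMod 2) →ₗ[ZMod 2] ZMod 2 := ∑ i, LinearMap.proj i with hs
  have hsurj : Function.Surjective s := by
    intro a
    obtain ⟨i⟩ := ‹Nonempty ι›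
    exact ⟨Pi.single i a, by simp [hs]⟩
  have := LinearMap.finrank_range_add_finrank_ker s
  rw [LinearMap.range_eq_top.2 hsurj, finrank_top, Module.finrank_self,
    Module.finrank_fintype_fun_eq_card] at this
  rw [← this, add_comm]
  rfl

/-- The linear map taking weights of the facets to their sums at the vertices. -/
def vertexSum {V Φ : Type*} (I : V → Finset Φ) : (Φ → ZMod 2) →ₗ[ZMod 2] (V → ZMod 2) :=
  LinearMap.pi fun v => ∑ F ∈ I v, LinearMap.proj F

theorem vertexSum_apply {V Φ : Type*} (I : V → Finset Φ) (x : Φ → ZMod 2) (v : V) :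
    vertexSum I x v = ∑ F ∈ I v, x F := by
  simp [vertexSum]

theorem mem_ker_vertexSum {V Φ : Type*} {I : V → Finset Φ} {x : Φ → ZMod 2} :
    x ∈ LinearMap.ker (vertexSum I) ↔ ∀ v, ∑ F ∈ I v, x F = 0 := by
  simp [LinearMap.mem_ker, funext_iff, vertexSum_apply]

/-- Restriction of the relations between the facet vectors to the facets at one vertex. -/
def restrictRelations {V Φ : Type*} (I : V → Finset Φ) (v₀ : V) :
    LinearMap.ker (vertexSum I) →ₗ[ZMod 2] sumZero (I v₀) :=
  LinearMap.codRestrict _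
    ((LinearMap.pi fun F : I v₀ => LinearMap.proj F.1).domRestrict _) fun x => by
      rw [mem_sumZero]
      have := mem_ker_vertexSum.1 x.2 v₀
      rw [← Finset.sum_coe_sort] at this
      exact this

theorem restrictRelations_apply {V Φ : Type*} (I : V → Finset Φ) (v₀ : V) (x : LinearMap.ker (vertexSum I))
    (F : I v₀) : (restrictRelations I v₀ x).1 F = x.1 F := rfl

namespace IsSimpleIncidence

variable {V Φ : Type*} [DecidableEq Φ] {n : ℕ} {I : V → Finset Φ} {h : V → ℝ}

theorem range_vertexSum [Fintype Φ] (H : IsSimpleIncidence n I h) :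
    LinearMap.range (vertexSum I) = incidenceCode I 1 := by
  have hsingle : ∀ F, vertexSum I (Pi.single F 1) = interVector I {F} := by
    intro F
    ext v
    simp [vertexSum_apply, interVector, Pi.single_apply]
  rw [LinearMap.range_eq_map, ← (Pi.basisFun (ZMod 2) Φ).span_eq, Submodule.map_span]
  congr 1
  ext x
  constructor
  · rintro ⟨_, ⟨F, rfl⟩, rfl⟩
    obtain ⟨v, hv⟩ := H.exists_mem F
    exact ⟨v, {F}, Finset.singleton_subset_iff.2 hv, Finset.card_singleton F, by
      rw [Pi.basisFun_apply, hsingle]⟩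
  · rintro ⟨v, A, -, hA, rfl⟩
    obtain ⟨F, rfl⟩ := Finset.card_eq_one.1 hA
    exact ⟨_, ⟨F, rfl⟩, by rw [Pi.basisFun_apply, hsingle]⟩

theorem finrank_code_one [Fintype V] [Fintype Φ] (H : IsSimpleIncidence n I h) :
    Module.finrank (ZMod 2) (incidenceCode I 1) +
      Module.finrank (ZMod 2) (LinearMap.ker (vertexSum I)) = Fintype.card Φ := by
  rw [← H.range_vertexSum, LinearMap.finrank_range_add_finrank_ker,
    Module.finrank_fintype_fun_eq_card]

/-- The ends of an edge differ by exchanging one facet for another. A relation sums to zero at both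
ends, so it takes equal values on the exchanged facets. -/
theorem exists_transport_of_edge (H : IsSimpleIncidence n I h) {v u : V} {F : Φ} (hF : F ∈ I v)
    (hu : (I v).erase F ⊆ I u) :
    ∃ σ : Φ → Φ, Set.MapsTo σ (I v) (I u) ∧ Set.InjOn σ (I v : Set Φ) ∧
      ∀ x ∈ LinearMap.ker (vertexSum I), ∀ G ∈ I v, x (σ G) = x G := by
  have h1 : (I u \ (I v).erase F).card = 1 := by
    rw [Finset.card_sdiff_of_subset hu, H.card_eq, Finset.card_erase_of_mem hF, H.card_eq]
    have := Finset.card_pos.2 ⟨F, hF⟩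
    rw [H.card_eq] at this
    omega
  obtain ⟨F', hF'⟩ := Finset.card_eq_one.1 h1
  have hmem : F' ∈ I u \ (I v).erase F := by simp [hF']
  rw [Finset.mem_sdiff] at hmem
  refine ⟨fun G => if G = F then F' else G, ?_, ?_, ?_⟩
  · intro G hG
    by_cases hGF : G = F
    · simpa [hGF] using hmem.1
    · simpa [hGF] using hu (Finset.mem_erase.2 ⟨hGF, hG⟩)
  · intro G hG K hK hGK
    by_cases hGF : G = F <;> by_cases hKF : K = F
    · rw [hGF, hKF]
    · simp only [hGF, hKF, if_true, if_false] at hGK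
      exact absurd (Finset.mem_erase.2 ⟨hKF, hK⟩) (hGK ▸ hmem.2)
    · simp only [hGF, hKF, if_true, if_false] at hGK
      exact absurd (Finset.mem_erase.2 ⟨hGF, hG⟩) (hGK ▸ hmem.2)
    · simpa [hGF, hKF] using hGK
  · intro x hx G hG
    by_cases hGF : G = F
    · subst hGF
      simp only [if_true]
      rw [mem_ker_vertexSum] at hx
      have hv := hx v
      have hu' := hx u
      rw [← Finset.add_sum_erase _ _ hG] at hv
      rw [← Finset.sum_sdiff hu, hF', Finset.sum_singleton] at hu'
      exact add_right_cancel (hu'.trans hv.symm)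
    · simp [hGF]

theorem exists_transport [Fintype V] (H : IsSimpleIncidence n I h) {v₀ : V}
    (h₀ : ∀ v, h v₀ ≤ h v) (v : V) :
    ∃ σ : Φ → Φ, Set.MapsTo σ (I v) (I v₀) ∧ Set.InjOn σ (I v : Set Φ) ∧
      ∀ x ∈ LinearMap.ker (vertexSum I), ∀ G ∈ I v, x (σ G) = x G := by
  have hwf : WellFounded fun a b : V => h a < h b :=
    @Finite.wellFounded_of_trans_of_irrefl V _ _ ⟨fun _ _ _ => lt_trans⟩ ⟨fun _ => lt_irrefl _⟩
  induction v using hwf.induction with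
  | _ v ih =>
    by_cases hv : v = v₀
    · subst hv
      exact ⟨id, Set.mapsTo_id _, Set.injOn_id _, fun _ _ _ _ => rfl⟩
    · have hlt : h v₀ < h v := lt_of_le_of_ne (h₀ v) fun heq => hv (H.injective heq.symm)
      obtain ⟨F, hF, u, hFu, hu⟩ := H.descent ∅ v v₀ (Finset.empty_subset _) hlt
      obtain ⟨σ, hσ, hσi, hσx⟩ := H.exists_transport_of_edge (Finset.mem_sdiff.1 hF).1 hFu
      obtain ⟨τ, hτ, hτi, hτx⟩ := ih u hu
      exact ⟨τ ∘ σ, hτ.comp hσ, hτi.comp hσi hσ, fun x hx G hG =>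
        (hτx x hx _ (hσ hG)).trans (hσx x hx G hG)⟩

theorem restrictRelations_injective [Fintype V] (H : IsSimpleIncidence n I h) {v₀ : V}
    (h₀ : ∀ v, h v₀ ≤ h v) : Function.Injective (restrictRelations I v₀) := by
  rw [← LinearMap.ker_eq_bot, LinearMap.ker_eq_bot']
  intro x hx
  ext F
  obtain ⟨v, hv⟩ := H.exists_mem F
  obtain ⟨σ, hσ, -, hσx⟩ := H.exists_transport h₀ v
  rw [← hσx x.1 x.2 F hv, ← restrictRelations_apply I v₀ x ⟨σ F, hσ hv⟩, hx]
  rfl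

theorem exists_lowest [Fintype V] (H : IsSimpleIncidence n I h) : ∃ v₀, ∀ v, h v₀ ≤ h v := by
  have := H.nonempty
  obtain ⟨v₀, -, hv₀⟩ := Finset.exists_min_image Finset.univ h Finset.univ_nonempty
  exact ⟨v₀, fun v => hv₀ v (Finset.mem_univ v)⟩

theorem finrank_sumZero_facets (H : IsSimpleIncidence n I h) (hn : 0 < n) (v : V) :
    Module.finrank (ZMod 2) (sumZero (I v)) + 1 = n := by
  have : Nonempty (I v) := by
    rw [Finset.nonempty_coe_sort, ← Finset.card_pos, H.card_eq]
    exact hn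
  rw [finrank_sumZero, Fintype.card_coe, H.card_eq]

/-- The upper bound is restriction to the facets at the lowest vertex. For the lower bound, sum-zero
functions on the colours pull back injectively to relations, as every vertex sees every colour once.
-/
theorem finrank_relations_of_proper [Fintype V] [Fintype Φ] (H : IsSimpleIncidence n I h)
    (hn : 0 < n) {c : Φ → Fin n} (hc : IsVertexProper I c) :
    Module.finrank (ZMod 2) (LinearMap.ker (vertexSum I)) + 1 = n := by
  obtain ⟨v₀, h₀⟩ := H.exists_lowest
  refine le_antisymm ?_ ?_
  · rw [← H.finrank_sumZero_facets hn v₀]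
    exact Nat.succ_le_succ
      (LinearMap.finrank_le_finrank_of_injective (H.restrictRelations_injective h₀))
  · have : Nonempty (Fin n) := ⟨⟨0, hn⟩⟩
    have hZ := finrank_sumZero (Fin n)
    rw [Fintype.card_fin] at hZ
    have hmem : ∀ a : sumZero (Fin n),
        (LinearMap.funLeft (ZMod 2) (ZMod 2) c).domRestrict (sumZero (Fin n)) a ∈
          LinearMap.ker (vertexSum I) := by
      intro a
      rw [mem_ker_vertexSum]
      intro v
      rw [← mem_sumZero.1 a.2]
      refine Finset.sum_bij (fun F _ => c F) (fun _ _ => Finset.mem_univ _)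
        (fun F hF G hG => hc v hF hG) (fun i _ => ?_) (fun _ _ => rfl)
      obtain ⟨F, hF, hFi⟩ := H.exists_unique_color (hc v) i
      exact ⟨F, hF, hFi⟩
    have hinj : Function.Injective (LinearMap.codRestrict _ _ hmem) := by
      rw [← LinearMap.ker_eq_bot, LinearMap.ker_codRestrict, LinearMap.ker_eq_bot']
      intro a ha
      ext i
      obtain ⟨F, -, hFi⟩ := H.exists_unique_color (hc v₀) i
      rw [← hFi]
      exact congrFun ha F
    rw [← hZ]
    exact Nat.succ_le_succ (LinearMap.finrank_le_finrank_of_injective hinj)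

theorem exists_proper_of_finrank [Fintype V] [Fintype Φ] (H : IsSimpleIncidence n I h)
    (hn : 3 ≤ n) (hrank : Module.finrank (ZMod 2) (LinearMap.ker (vertexSum I)) + 1 = n) :
    ∃ c : Φ → Fin n, IsVertexProper I c := by
  obtain ⟨v₀, h₀⟩ := H.exists_lowest
  have hsurj : Function.Surjective (restrictRelations I v₀) :=
    (LinearMap.injective_iff_surjective_of_finrank_eq_finrank (by
      have := H.finrank_sumZero_facets (by omega) v₀
      omega)).1 (H.restrictRelations_injective h₀)
  -- This is where `3 ≤ n` matters: a third facet `K` at `v₀` makes the indicator of `{F, K}` a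
  -- sum-zero vector that tells `F` from `G`. With two facets the only nonzero sum-zero vector is
  -- constant.
  have hsep : ∀ F ∈ I v₀, ∀ G ∈ I v₀,
      (∀ x ∈ LinearMap.ker (vertexSum I), x F = x G) → F = G := by
    intro F hF G hG hFG
    by_contra hne
    obtain ⟨K, hK, hKFG⟩ := Finset.exists_mem_notMem_of_card_lt_card
      (s := {F, G}) (t := I v₀) (by rw [Finset.card_pair hne, H.card_eq]; omega)
    simp only [Finset.mem_insert, Finset.mem_singleton, not_or] at hKFG
    obtain ⟨x, hx⟩ := hsurj ⟨Pi.single ⟨F, hF⟩ 1 + Pi.single ⟨K, hK⟩ 1, by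
      rw [mem_sumZero]
      simp only [Pi.add_apply, Finset.sum_add_distrib, Finset.sum_pi_single', Finset.mem_univ,
        if_true]
      rfl⟩
    have h1 := restrictRelations_apply I v₀ x ⟨F, hF⟩
    have h2 := restrictRelations_apply I v₀ x ⟨G, hG⟩
    rw [hx] at h1 h2
    have h3 := hFG x.1 x.2
    rw [← h1, ← h2] at h3
    simp [Ne.symm hKFG.1, Ne.symm hKFG.2, Ne.symm hne] at h3
  have hrep : ∀ F, ∃ G : I v₀, ∀ x ∈ LinearMap.ker (vertexSum I), x G = x F := by
    intro F
    obtain ⟨v, hv⟩ := H.exists_mem F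
    obtain ⟨σ, hσ, -, hσx⟩ := H.exists_transport h₀ v
    exact ⟨⟨σ F, hσ hv⟩, fun x hx => hσx x hx F hv⟩
  -- The colour of a facet is the facet at `v₀` on which all relations take the same values.
  -- Properness at `v` follows because transport to `v₀` is injective on `I v`.
  choose r hr using hrep
  refine ⟨fun F => (I v₀).equivFinOfCardEq (H.card_eq v₀) (r F), fun v F hF G hG hFG => ?_⟩
  have hrFG : r F = r G := ((I v₀).equivFinOfCardEq (H.card_eq v₀)).injective hFG
  obtain ⟨σ, hσ, hσi, hσx⟩ := H.exists_transport h₀ v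
  refine hσi hF hG (hsep _ (hσ hF) _ (hσ hG) fun x hx => ?_)
  rw [hσx x hx F hF, hσx x hx G hG, ← hr F x hx, ← hr G x hx, hrFG]

theorem exists_proper_iff_finrank [Fintype V] [Fintype Φ] (H : IsSimpleIncidence n I h)
    (hn : 0 < n) (hn2 : n ≠ 2) : (∃ c : Φ → Fin n, IsVertexProper I c) ↔
      Module.finrank (ZMod 2) (incidenceCode I 1) + n = Fintype.card Φ + 1 := by
  have hc := H.finrank_code_one
  constructor
  · rintro ⟨c, hproper⟩
    have := H.finrank_relations_of_proper hn hproper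
    omega
  · intro hrank
    rcases Nat.lt_or_ge n 2 with hlt | hge
    · exact H.exists_proper_of_eq_one (by omega)
    · exact H.exists_proper_of_finrank (by omega) (by omega)

end IsSimpleIncidence

end Rank

/-! ### Translation between the polytope and its incidences. -/

section FaceCodeIncidence

variable {E : Type*} [NormedAddCommGroup E] [NormedSpace ℝ E] {n : ℕ} {P : Set E}

theorem IsSimplePolytope.exists_isSimpleIncidence [FiniteDimensional ℝ E]
    [Fintype (polyFacets P)] [DecidableEq (polyFacets P)] (hP : IsSimplePolytope n P)
    (hn : 1 ≤ n) :
    ∃ h, IsSimpleIncidence n (fun v : P.extremePoints ℝ => facetsAt P (v : E)) h := by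
  have hfin : Finite (P.extremePoints ℝ) := hP.isConvexPolytope.finite_extremePoints
  -- A generic functional is nonzero on the finitely many differences of distinct vertices, which
  -- makes the height injective.
  obtain ⟨l, hl⟩ := Module.exists_dual_forall_apply_ne_zero (K := ℝ)
    (fun p : {p : P.extremePoints ℝ × P.extremePoints ℝ // p.1 ≠ p.2} =>
      (p.1.1 : E) - (p.1.2 : E))
    fun p => sub_ne_zero.2 fun heq => p.2 (Subtype.ext heq)
  have hdescent : ∀ (l : E →L[ℝ] ℝ) (A : Finset (polyFacets P)) (v w : P.extremePoints ℝ),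
      A ⊆ facetsAt P (w : E) → l w < l v → ∃ F ∈ facetsAt P (v : E) \ A,
        ∃ u : P.extremePoints ℝ, (facetsAt P (v : E)).erase F ⊆ facetsAt P (u : E) ∧
          l u < l v := by
    intro l A v w hw hlt
    obtain ⟨t, e, h⟩ := hP.exists_isVertexFrame v.2
    obtain ⟨F, hF, u, hu, huF, hlu⟩ := h.exists_descent hP.isConvexPolytope l
      ((mem_facetInter_iff_subset w.2.1).2 hw) hlt
    exact ⟨F, hF, ⟨u, hu⟩, (mem_facetInter_iff_subset hu.1).1 huF, hlu⟩
  refine ⟨fun v => l v, ?_, fun v => hP.card_facetsAt v.2, ?_, ?_, ?_,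
    hdescent (LinearMap.toContinuousLinearMap l), ?_⟩
  · have hne : P.Nonempty := by
      rw [Set.nonempty_iff_ne_empty]
      rintro rfl
      have := hP.polyDim_eq
      rw [polyDim, vectorSpan_empty, finrank_bot] at this
      omega
    exact (hP.isConvexPolytope.isCompact.extremePoints_nonempty hne).to_subtype
  · intro F
    obtain ⟨v, hv, hvF⟩ := F.2.1.exists_vertex hP.isConvexPolytope
    exact ⟨⟨v, hv⟩, mem_facetsAt.2 hvF⟩
  · intro v F hF
    obtain ⟨t, e, h⟩ := hP.exists_isVertexFrame v.2
    obtain ⟨u, hu, huv, huF⟩ := h.exists_adjacent hP.isConvexPolytope hF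
    refine ⟨⟨u, hu⟩, fun heq => huv (congrArg Subtype.val heq),
      (mem_facetInter_iff_subset hu.1).1 huF, fun w hwv hw => Subtype.ext ?_⟩
    exact h.adjacent_unique hF w.2 (fun heq => hwv (Subtype.ext heq))
      ((mem_facetInter_iff_subset w.2.1).2 hw) hu huv huF
  · intro v w heq
    by_contra hne
    exact hl ⟨(v, w), hne⟩ (by simpa [sub_eq_zero] using heq)
  · intro A v w hw hlt
    obtain ⟨F, hF, u, hu, hlu⟩ := hdescent (-LinearMap.toContinuousLinearMap l) A v w hw
      (by simpa using hlt)
    exact ⟨F, hF, u, hu, by simpa using hlu⟩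

theorem IsSimplePolytope.faceCode_eq [FiniteDimensional ℝ E] [Fintype (polyFacets P)]
    [DecidableEq (polyFacets P)] (hP : IsSimplePolytope n P) (k : ℕ) :
    faceCode P k = incidenceCode (fun v : P.extremePoints ℝ => facetsAt P (v : E)) k := by
  have hvec : ∀ A, faceVector P (facetInter P A) =
      interVector (fun v : P.extremePoints ℝ => facetsAt P (v : E)) A := by
    intro A
    ext v
    simp only [faceVector, interVector, mem_facetInter_iff_subset v.2.1]
  unfold faceCode incidenceCode
  congr 1
  ext x
  simp only [Set.mem_ofPred_eq, hP.isCodimFace_iff]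
  constructor
  · rintro ⟨_, ⟨v, hv, A, hA, hk, rfl⟩, rfl⟩
    exact ⟨⟨v, hv⟩, A, hA, hk, hvec A⟩
  · rintro ⟨v, A, hA, hk, rfl⟩
    exact ⟨_, ⟨v, v.2, A, hA, hk, rfl⟩, (hvec A).symm⟩

theorem IsConvexPolytope.isPolyColorable_iff [Fintype (polyFacets P)]
    (hP : IsConvexPolytope P) : IsPolyColorable n P ↔ ∃ c : polyFacets P → Fin n,
      IsVertexProper (fun v : P.extremePoints ℝ => facetsAt P (v : E)) c := by
  refine exists_congr fun c => ⟨fun hc v F hF G hG hFG => ?_, fun hc F G hne hFG heq => ?_⟩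
  · by_contra hne
    exact hc F G hne ⟨v, mem_facetsAt.1 hF, mem_facetsAt.1 hG⟩ hFG
  · obtain ⟨v, hv, hvF, hvG⟩ := F.2.1.inter_exists_vertex hP G.2.1 hFG
    exact hne (hc ⟨v, hv⟩ (mem_facetsAt.2 hvF) (mem_facetsAt.2 hvG) heq)

theorem HasFacetPartition.isPolyColorable (hpart : HasFacetPartition n P) :
    IsPolyColorable n P := by
  obtain ⟨𝓕, hmem, -, hclass⟩ := hpart
  choose c hc using fun F : polyFacets P => (hmem F).1 F.2
  refine ⟨c, fun F G hne hFG heq => ?_⟩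
  have := (hclass (c F)).1 F (hc F) G (heq ▸ hc G) fun h => hne (Subtype.ext h)
  exact Set.not_disjoint_iff_nonempty_inter.2 hFG this

theorem IsSimplePolytope.hasFacetPartition_of_proper [FiniteDimensional ℝ E]
    [Fintype (polyFacets P)] (hP : IsSimplePolytope n P) (hn : 1 ≤ n) (hc : IsPolyColorable n P) :
    HasFacetPartition n P := by
  classical
  obtain ⟨c, hcol⟩ := hc
  obtain ⟨h, H⟩ := hP.exists_isSimpleIncidence hn
  have hproper : IsVertexProper (fun v : P.extremePoints ℝ => facetsAt P (v : E)) c := by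
    intro v F hF G hG hFG
    by_contra hne
    exact hcol F G hne ⟨v, mem_facetsAt.1 hF, mem_facetsAt.1 hG⟩ hFG
  refine ⟨fun i => (Finset.univ.filter fun F => c F = i).map ⟨Subtype.val, Subtype.val_injective⟩,
    fun F => ?_, fun i j hij => ?_, fun i => ⟨?_, ?_⟩⟩
  · simp
  · rw [Finset.disjoint_map, Finset.disjoint_filter]
    rintro F - rfl
    exact hij
  · simp only [Finset.mem_map, Finset.mem_filter, Finset.mem_univ, true_and,
      Function.Embedding.coeFn_mk]
    rintro _ ⟨F, hF, rfl⟩ _ ⟨G, hG, rfl⟩ hne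
    by_contra hdisj
    exact hcol F G (fun h => hne (h ▸ rfl)) (Set.not_disjoint_iff_nonempty_inter.1 hdisj)
      (hF.trans hG.symm)
  · ext v
    rw [Finset.sum_map, Finset.sum_apply]
    simp only [Function.Embedding.coeFn_mk, faceVector, Finset.sum_boole, Finset.filter_filter]
    have := H.card_filter_color (hproper v) i
    rw [show (Finset.univ.filter fun F : polyFacets P => c F = i ∧ (v : E) ∈ (F : Set E)) =
      (facetsAt P (v : E)).filter fun F => c F = i by ext; simp [and_comm], this]
    rfl

theorem faceCode_neg_one (P : Set E) [FiniteDimensional ℝ E] :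
    faceCode P (-1) = ⊥ := by
  refine (Submodule.span_eq_bot).2 ?_
  rintro _ ⟨f, ⟨hf, hdim⟩, rfl⟩
  have : polyDim f ≤ polyDim P := Submodule.finrank_mono (vectorSpan_mono ℝ hf.subset)
  omega

end FaceCodeIncidence

theorem proposition5p5 {E : Type*} [NormedAddCommGroup E] [NormedSpace ℝ E]
    [FiniteDimensional ℝ E] (n m : ℕ) (hn : 1 ≤ n) (P : Set E) (hP : IsSimplePolytope n P)
    (hm : (polyFacets P).ncard = m) :
    List.TFAE
      [ IsPolyColorable n P,
        HasFacetPartition n P,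
        (∀ k : ℕ, k < n → faceCode P (k : ℤ) ≤ faceCode P ((k : ℤ) + 1)) ∧
          faceCode P (n : ℤ) = ⊤,
        faceCode P ((n : ℤ) - 2) ≤ faceCode P ((n : ℤ) - 1) ] ∧
    (n ≠ 2 →
      (IsPolyColorable n P ↔
        (Module.finrank (ZMod 2) (faceCode P 1) : ℤ) = (m : ℤ) - (n : ℤ) + 1)) := by
  classical
  have : Fintype (polyFacets P) := (finite_polyFacets hP.isConvexPolytope).fintype
  have : Fintype (P.extremePoints ℝ) := hP.isConvexPolytope.finite_extremePoints.fintype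
  obtain ⟨h, H⟩ := hP.exists_isSimpleIncidence hn
  have hcol := hP.isConvexPolytope.isPolyColorable_iff (n := n)
  refine ⟨?_, fun hn2 => ?_⟩
  · tfae_have 1 → 2 := hP.hasFacetPartition_of_proper hn
    tfae_have 2 → 1 := HasFacetPartition.isPolyColorable
    tfae_have 1 → 3 := by
      intro hc
      obtain ⟨c, hc⟩ := hcol.1 hc
      refine ⟨fun k hk => ?_, by rw [hP.faceCode_eq, H.code_eq_top]⟩
      rw [← Nat.cast_succ, hP.faceCode_eq, hP.faceCode_eq]
      exact H.code_le_of_proper hc hk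
    tfae_have 3 → 4 := by
      rintro ⟨hle, -⟩
      rcases Nat.lt_or_ge n 2 with hlt | hge
      · rw [show (n : ℤ) - 2 = -1 by omega, faceCode_neg_one]
        exact bot_le
      · have := hle (n - 2) (by omega)
        rwa [show ((n - 2 : ℕ) : ℤ) = n - 2 by omega, show (n : ℤ) - 2 + 1 = n - 1 by ring] at this
    tfae_have 4 → 1 := by
      intro hle
      rw [hcol]
      -- For `n = 1` the inclusion is 𝔅₋₁ ⊂ 𝔅₀ and carries no information, but one colour suffices
      -- because each vertex lies on one facet.
      rcases Nat.lt_or_ge n 2 with hlt | hge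
      · exact H.exists_proper_of_eq_one (by omega)
      · obtain ⟨k, rfl⟩ := Nat.exists_eq_add_of_le' hge
        rw [show ((k + 2 : ℕ) : ℤ) - 2 = (k : ℕ) by push_cast; ring,
          show ((k + 2 : ℕ) : ℤ) - 1 = (k + 1 : ℕ) by push_cast; ring,
          hP.faceCode_eq, hP.faceCode_eq] at hle
        exact H.exists_proper_of_code_le rfl hle
    tfae_finish
  · have hcode := hP.faceCode_eq 1
    rw [Nat.cast_one] at hcode
    rw [hcol, H.exists_proper_iff_finrank hn hn2, hcode]
    have hm' : Fintype.card (polyFacets P) = m := by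
      rw [← hm, ← Nat.card_coe_set_eq, Nat.card_eq_fintype_card]
    rw [hm']
    omega
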